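/- Let $\ell>0$, let $q:\mathbb R\to\mathbb R$ be locally integrable and $\ell$-periodic, and let $\alpha\in[0,\pi)$. Consider $-y''+qy=\lambda y$ on $[0,\infty)$ (solutions have locally absolutely continuous $y,y'$ and satisfy the equation almost everywhere). For $\lambda\in\mathbb C$ let $\theta,\phi$ be the solutions with $\theta(0)=\cos\alpha$, $\theta'(0)=\sin\alpha$, $\phi(0)=-\sin\alpha$, $\phi'(0)=\cos\alpha$, and let $u,v$ be those with $u(0)=v'(0)=1$, $u'(0)=v(0)=0$. For $\operatorname{Im}\lambda\ne0$ let $m(\lambda)$ be the Titchmarsh–Weyl coefficient, i.e. the number with $\theta+m(\lambda)\phi\in L^2(0,\infty)$. Let $\Lambda$ be the cutoff point (the equation is nonoscillatory for $\lambda<\Lambda$, oscillatory for $\lambda>\Lambda$), let $\rho(\lambda)=\lim_{\varepsilon\to0+}\frac1\pi\int_\Lambda^\lambda\operatorname{Im}m(\mu+i\varepsilon)\,d\mu$ be the spectral function, and let $f(\lambda)=\rho'(\lambda)=\frac1\pi\lim_{\varepsilon\to0+}\operatorname{Im}m(\lambda+i\varepsilon)$ be the spectral density function. Let $\lambda_0\le\lambda_1\le\cdots$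 and $\mu_0\le\mu_1\le\cdots$ be the eigenvalues, repeated according to multiplicity, of the equation on $[0,\ell]$ with the periodic conditions $y(0)=y(\ell)$, $y'(0)=y'(\ell)$ and the semi-periodic conditions $y(0)=-y(\ell)$, $y'(0)=-y'(\ell)$, respectively. Let $\lambda$ lie in a stability interval, i.e. in one of the open intervals $(\lambda_{2m},\mu_{2m})$, $(\mu_{2m+1},\lambda_{2m+1})$, $m\ge0$. Then Appell's system $$P'=(\lambda-q)Q,\qquad Q'=-2P+2(\lambda-q)R,\qquad R'=-Q$$ has on $[0,\infty)$ a real $\ell$-periodic solution $U=(P,Q,R)^T$ with $4PR-Q^2=4$, and it is unique up to sign. The limit defining $f(\lambda)$ exists, is positive, and equals $\rho'(\lambda)$. For each such $U$ there are real $a,b,c$ with $$\begin{pmatrix}P\\Q\\R\end{pmatrix}=a\begin{pmatrix}u'^2\\-2uu'\\u^2\end{pmatrix}+b\begin{pmatrix}u'v'\\-(u'v+uv')\\uv\end{pmatrix}+c\begin{pmatrix}v'^2\\-2vv'\\v^2\end{pmatrix},$$ and for any such $a,b,c$, $$f(\lambda)=\left|\frac1{\pi[c\sin^2\alpha+b\sin\alpha\cos\alpha+a\cos^2\alpha]}\right|=\left|\frac1{\pi[P(0)\sin^2\alpha-Q(0)\sin\alpha\cos\alpha+R(0)\cos^2\alpha]}\right|=\left|\frac1{\pi[P(x)\phi(x)^2+Q(x)\phi(x)\phi'(x)+R(x)\phi'(x)^2]}\right|$$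 for every $x\ge0$, where $P\phi^2+Q\phi\phi'+R\phi'^2$ does not depend on $x$. -/

import Mathlib

open Filter Topology MeasureTheory

/-- `(y, dy)` is a solution, together with its derivative, of `-y'' + q y = z y` on `[0, ∞)`.
For a locally integrable potential this is the usual (Carathéodory) notion: `y` and `y' = dy` are
locally absolutely continuous and the equation holds almost everywhere, written in integrated form.
For a continuous potential these are the classical solutions. -/
structure IsHillSolution {𝕜 : Type*} [RCLike 𝕜] (q : ℝ → ℝ) (z : 𝕜) (y dy : ℝ → 𝕜) : Prop where
  continuousOn : ContinuousOn y (Set.Ici 0)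
  continuousOn_deriv : ContinuousOn dy (Set.Ici 0)
  eq : ∀ x, 0 ≤ x → y x = y 0 + ∫ t in (0 : ℝ)..x, dy t
  deriv_eq : ∀ x, 0 ≤ x → dy x = dy 0 + ∫ t in (0 : ℝ)..x, ((q t : 𝕜) - z) * y t

/-- `(P, Q, R)` is a solution on `[0, ∞)` of Appell's system
`P' = (lam - q) Q`, `Q' = -2 P + 2 (lam - q) R`, `R' = -Q`, in the same sense. -/
structure IsAppellSolution (q : ℝ → ℝ) (lam : ℝ) (P Q R : ℝ → ℝ) : Prop where
  continuousOn_P : ContinuousOn P (Set.Ici 0)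
  continuousOn_Q : ContinuousOn Q (Set.Ici 0)
  continuousOn_R : ContinuousOn R (Set.Ici 0)
  eq_P : ∀ x, 0 ≤ x → P x = P 0 + ∫ t in (0 : ℝ)..x, (lam - q t) * Q t
  eq_Q : ∀ x, 0 ≤ x → Q x = Q 0 + ∫ t in (0 : ℝ)..x, (-2 * P t + 2 * (lam - q t) * R t)
  eq_R : ∀ x, 0 ≤ x → R x = R 0 + ∫ t in (0 : ℝ)..x, -Q t

/-- `(P, Q, R)` is an `ℓ`-periodic solution of Appell's system with `4 P R - Q ^ 2 = 4`. -/
structure IsNormalizedPeriodicAppell (q : ℝ → ℝ) (ℓ lam : ℝ) (P Q R : ℝ → ℝ) : Prop where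
  solution : IsAppellSolution q lam P Q R
  periodic_P : ∀ x, 0 ≤ x → P (x + ℓ) = P x
  periodic_Q : ∀ x, 0 ≤ x → Q (x + ℓ) = Q x
  periodic_R : ∀ x, 0 ≤ x → R (x + ℓ) = R x
  normalized : ∀ x, 0 ≤ x → 4 * P x * R x - Q x ^ 2 = 4

/-- `(P, Q, R) = a U₁ + b U₂ + c U₃`, where `U₁, U₂, U₃` is the fundamental system of Appell's
system that is generated by two solutions `u`, `v` of the equation. -/
def HasAppellCoordinates (u du v dv P Q R : ℝ → ℝ) (a b c : ℝ) : Prop :=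
  ∀ x, 0 ≤ x →
    P x = a * du x ^ 2 + b * (du x * dv x) + c * dv x ^ 2 ∧
    Q x = a * (-2 * u x * du x) + b * (-(du x * v x + u x * dv x)) + c * (-2 * v x * dv x) ∧
    R x = a * u x ^ 2 + b * (u x * v x) + c * v x ^ 2

/-! ### Stability intervals -/

/-- The multiplicity of `μ` as an eigenvalue of `-y'' + q y = μ y` on `[0, ℓ]` with the boundary
conditions `y 0 = s * y ℓ`, `y' 0 = s * y' ℓ` (periodic for `s = 1`, semi-periodic for `s = -1`):
the dimension of the space of eigenfunctions, which are identified with their initial data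
`(y 0, y' 0)`. It is `0` if `μ` is not an eigenvalue. -/
noncomputable def eigenvalueMultiplicity (q : ℝ → ℝ) (ℓ s μ : ℝ) : ℕ :=
  Set.finrank ℝ {d : ℝ × ℝ | ∃ y dy : ℝ → ℝ, IsHillSolution q μ y dy ∧
    y 0 = d.1 ∧ dy 0 = d.2 ∧ y 0 = s * y ℓ ∧ dy 0 = s * dy ℓ}

/-- `e 0 ≤ e 1 ≤ e 2 ≤ ⋯` lists all eigenvalues of the problem above, each as often as its
multiplicity says. -/
def IsEigenvalueSequence (q : ℝ → ℝ) (ℓ s : ℝ) (e : ℕ → ℝ) : Prop :=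
  Monotone e ∧ ∀ μ : ℝ, {n : ℕ | e n = μ}.encard = (eigenvalueMultiplicity q ℓ s μ : ℕ∞)

/-- `lam` lies in one of the open stability intervals `(λ_{2m}, μ_{2m})`,
`(μ_{2m+1}, λ_{2m+1})`, where `λ_n` and `μ_n` are the periodic and the semi-periodic
eigenvalues. -/
def InStabilityInterval (q : ℝ → ℝ) (ℓ lam : ℝ) : Prop :=
  ∃ per semi : ℕ → ℝ, IsEigenvalueSequence q ℓ 1 per ∧ IsEigenvalueSequence q ℓ (-1) semi ∧
    ∃ m : ℕ, lam ∈ Set.Ioo (per (2 * m)) (semi (2 * m)) ∨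
      lam ∈ Set.Ioo (semi (2 * m + 1)) (per (2 * m + 1))

/-! ### The Titchmarsh–Weyl function, the spectral function and the spectral density -/

/-- `θ + m φ` is square integrable on `(0, ∞)`, where `θ`, `φ` are the solutions with
`θ 0 = cos α`, `θ' 0 = sin α`, `φ 0 = -sin α`, `φ' 0 = cos α`. -/
def IsWeylCoefficient (q : ℝ → ℝ) (α : ℝ) (z m : ℂ) : Prop :=
  ∃ θ dθ φ dφ : ℝ → ℂ, IsHillSolution q z θ dθ ∧ IsHillSolution q z φ dφ ∧
    θ 0 = Real.cos α ∧ dθ 0 = Real.sin α ∧ φ 0 = -Real.sin α ∧ dφ 0 = Real.cos α ∧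
    MemLp (fun x => θ x + m * φ x) 2 (volume.restrict (Set.Ioi 0))

/-- The Titchmarsh–Weyl `m`-function (for `z.im ≠ 0`). -/
noncomputable def weylM (q : ℝ → ℝ) (α : ℝ) (z : ℂ) : ℂ :=
  Classical.epsilon (IsWeylCoefficient q α z)

/-- Every nontrivial real solution has arbitrarily large zeros. -/
def IsOscillatory (q : ℝ → ℝ) (μ : ℝ) : Prop :=
  ∀ y dy : ℝ → ℝ, IsHillSolution q μ y dy → (∃ x, 0 ≤ x ∧ y x ≠ 0) →
    ∀ X : ℝ, ∃ x, 0 ≤ x ∧ X ≤ x ∧ y x = 0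

/-- No nontrivial real solution has arbitrarily large zeros. -/
def IsNonoscillatory (q : ℝ → ℝ) (μ : ℝ) : Prop :=
  ∀ y dy : ℝ → ℝ, IsHillSolution q μ y dy → (∃ x, 0 ≤ x ∧ y x ≠ 0) →
    ∃ X : ℝ, ∀ x, 0 ≤ x → X ≤ x → y x ≠ 0

/-- The cutoff point: nonoscillation below `Λ`, oscillation above `Λ`. -/
def IsCutoff (q : ℝ → ℝ) (Λ : ℝ) : Prop :=
  (∀ μ, μ < Λ → IsNonoscillatory q μ) ∧ ∀ μ, Λ < μ → IsOscillatory q μ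

/-- `ρ` is the spectral function on `[Λ, ∞)` given by the Titchmarsh–Kodaira formula. -/
def IsSpectralFunction (q : ℝ → ℝ) (α Λ : ℝ) (ρ : ℝ → ℝ) : Prop :=
  ∀ μ, Λ ≤ μ → Tendsto
    (fun ε : ℝ => 1 / Real.pi * ∫ t in Λ..μ, (weylM q α (t + ε * Complex.I)).im)
    (𝓝[>] 0) (𝓝 (ρ μ))

/-- The spectral density `f(lam) = (1/π) lim_{ε → 0+} Im m(lam + i ε)`. -/
noncomputable def spectralDensity (q : ℝ → ℝ) (α lam : ℝ) : ℝ :=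
  limUnder (𝓝[>] (0 : ℝ)) fun ε : ℝ => 1 / Real.pi * (weylM q α (lam + ε * Complex.I)).im

/-!
In the upper half-plane `weylM` is a quotient of entries of the monodromy matrix and of its
eigenvalue `τ` of modulus less than `1`. Where the discriminant `D` lies in `(-2, 2)`, both roots of
`τ ^ 2 - D * τ + 1` extend continuously to the real axis, and the imaginary part of the boundary
value of `weylM` is `√(4 - D ^ 2) / 2` divided by the quadratic form that the monodromy matrix
preserves, evaluated at the initial data of `φ`. The normalized periodic solutions of Appell's
system are the two multiples of this form that have discriminant `-4`, and Appell's system says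
precisely that `P * y ^ 2 + Q * y * y' + R * y' ^ 2` is constant along solutions of Hill's equation.

A stability interval is defined by counting eigenvalues. The number of periodic minus the number of
semi-periodic eigenvalues below `x` vanishes for `x` near `-∞`, and across each point it jumps
exactly as an index that is read off the discriminant and is nonzero only where `D ^ 2 < 4`.
-/

/-! ### Absolutely continuous functions on the half-line -/

/-- `F` is the primitive on `[0, ∞)` of the locally integrable function `f`: it is locally
absolutely continuous with `F' = f` almost everywhere. -/
structure IsPrimitive {E : Type*} [NormedAddCommGroup E] [NormedSpace ℝ E] (F f : ℝ → E) :
    Prop where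
  intervalIntegrable : ∀ x, 0 ≤ x → IntervalIntegrable f volume 0 x
  eq : ∀ x, 0 ≤ x → F x = F 0 + ∫ t in (0 : ℝ)..x, f t

namespace IsPrimitive

section NormedSpace

variable {E E' : Type*} [NormedAddCommGroup E] [NormedSpace ℝ E] [NormedAddCommGroup E']
  [NormedSpace ℝ E'] {F f G g : ℝ → E}

theorem of_continuousOn (hf : ContinuousOn f (Set.Ici 0))
    (h : ∀ x, 0 ≤ x → F x = F 0 + ∫ t in (0 : ℝ)..x, f t) : IsPrimitive F f where
  intervalIntegrable x hx := (hf.mono (by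
    rw [Set.uIcc_of_le hx]
    exact Set.Icc_subset_Ici_self)).intervalIntegrable
  eq := h

theorem congr (h : IsPrimitive F f) (hFG : ∀ x, 0 ≤ x → F x = G x) : IsPrimitive G f where
  intervalIntegrable := h.intervalIntegrable
  eq x hx := by rw [← hFG x hx, ← hFG 0 le_rfl, h.eq x hx]

theorem congr_density (h : IsPrimitive F f) (hfg : ∀ x, 0 ≤ x → f x = g x) : IsPrimitive F g where
  intervalIntegrable x hx := (h.intervalIntegrable x hx).congr fun t ht => by
    rw [Set.uIoc_of_le hx] at ht
    exact hfg t ht.1.le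
  eq x hx := by
    rw [h.eq x hx, intervalIntegral.integral_congr fun t ht => ?_]
    rw [Set.uIcc_of_le hx] at ht
    exact hfg t ht.1

theorem sub_eq (hF : IsPrimitive F f) {x y : ℝ} (hx : 0 ≤ x) (hy : 0 ≤ y) :
    F y - F x = ∫ t in x..y, f t := by
  rw [hF.eq x hx, hF.eq y hy, add_sub_add_left_eq_sub, intervalIntegral.integral_interval_sub_left
    (hF.intervalIntegrable y hy) (hF.intervalIntegrable x hx)]

theorem eq_of_density_eq_zero (hF : IsPrimitive F f) (hf : ∀ x, 0 ≤ x → f x = 0) {x : ℝ}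
    (hx : 0 ≤ x) : F x = F 0 := by
  rw [(hF.congr_density hf).eq x hx, intervalIntegral.integral_zero, add_zero]

theorem add (hF : IsPrimitive F f) (hG : IsPrimitive G g) :
    IsPrimitive (fun x => F x + G x) (fun x => f x + g x) where
  intervalIntegrable x hx := (hF.intervalIntegrable x hx).add (hG.intervalIntegrable x hx)
  eq x hx := by
    rw [intervalIntegral.integral_add (hF.intervalIntegrable x hx) (hG.intervalIntegrable x hx),
      hF.eq x hx, hG.eq x hx, add_add_add_comm]

theorem sub (hF : IsPrimitive F f) (hG : IsPrimitive G g) :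
    IsPrimitive (fun x => F x - G x) (fun x => f x - g x) where
  intervalIntegrable x hx := (hF.intervalIntegrable x hx).sub (hG.intervalIntegrable x hx)
  eq x hx := by
    rw [intervalIntegral.integral_sub (hF.intervalIntegrable x hx) (hG.intervalIntegrable x hx),
      hF.eq x hx, hG.eq x hx, add_sub_add_comm]

theorem clm_comp [CompleteSpace E] [CompleteSpace E'] (L : E →L[ℝ] E') (hF : IsPrimitive F f) :
    IsPrimitive (fun x => L (F x)) (fun x => L (f x)) where
  intervalIntegrable x hx := intervalIntegrable_iff.2
    (L.integrable_comp (intervalIntegrable_iff.1 (hF.intervalIntegrable x hx)))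
  eq x hx := by
    rw [L.intervalIntegral_comp_comm (hF.intervalIntegrable x hx), hF.eq x hx, map_add]

theorem comp_add_right (hF : IsPrimitive F f) {c : ℝ} (hc : 0 ≤ c) :
    IsPrimitive (fun x => F (x + c)) (fun x => f (x + c)) where
  intervalIntegrable x hx := by
    simpa using ((hF.intervalIntegrable c hc).symm.trans
      (hF.intervalIntegrable (x + c) (by positivity))).comp_add_right c
  eq x hx := by
    rw [intervalIntegral.integral_comp_add_right, zero_add,
      ← hF.sub_eq hc (by positivity), add_sub_cancel]

theorem continuousOn (h : IsPrimitive F f) : ContinuousOn F (Set.Ici 0) := by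
  intro x (hx : 0 ≤ x)
  have hprim : ContinuousOn (fun b => F 0 + ∫ t in (0 : ℝ)..b, f t) (Set.uIcc 0 (x + 1)) :=
    continuousOn_const.add (intervalIntegral.continuousOn_primitive_interval'
      (h.intervalIntegrable (x + 1) (by linarith)) Set.left_mem_uIcc)
  rw [Set.uIcc_of_le (by linarith)] at hprim
  have hF : ContinuousOn F (Set.Icc 0 (x + 1)) := hprim.congr fun y hy => h.eq y hy.1
  refine (hF x ⟨hx, by linarith⟩).mono_of_mem_nhdsWithin ?_
  rw [← Set.Ici_inter_Iic]
  exact inter_mem_nhdsWithin _ (Iic_mem_nhds (by linarith))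

theorem continuousOn_uIcc (h : IsPrimitive F f) {x : ℝ} (hx : 0 ≤ x) :
    ContinuousOn F (Set.uIcc 0 x) := by
  rw [Set.uIcc_of_le hx]
  exact h.continuousOn.mono Set.Icc_subset_Ici_self

end NormedSpace

section RCLike

variable {𝕜 : Type*} [RCLike 𝕜] {F f G g : ℝ → 𝕜}

theorem const_mul (c : 𝕜) (hF : IsPrimitive F f) :
    IsPrimitive (fun x => c * F x) (fun x => c * f x) :=
  hF.clm_comp (ContinuousLinearMap.mul ℝ 𝕜 c)

theorem re (hF : IsPrimitive F f) :
    IsPrimitive (fun x => RCLike.re (F x)) (fun x => RCLike.re (f x)) :=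
  hF.clm_comp RCLike.reCLM

theorem im (hF : IsPrimitive F f) :
    IsPrimitive (fun x => RCLike.im (F x)) (fun x => RCLike.im (f x)) :=
  hF.clm_comp RCLike.imCLM

theorem ofReal {F f : ℝ → ℝ} (hF : IsPrimitive F f) :
    IsPrimitive (fun x => (F x : 𝕜)) (fun x => (f x : 𝕜)) :=
  hF.clm_comp (RCLike.ofRealCLM (K := 𝕜))

theorem conj (hF : IsPrimitive F f) :
    IsPrimitive (fun x => starRingEnd 𝕜 (F x)) (fun x => starRingEnd 𝕜 (f x)) :=
  hF.clm_comp (RCLike.conjCLE (K := 𝕜) : 𝕜 →L[ℝ] 𝕜)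

theorem of_re_im (hre : IsPrimitive (fun x => RCLike.re (F x)) (fun x => RCLike.re (f x)))
    (him : IsPrimitive (fun x => RCLike.im (F x)) (fun x => RCLike.im (f x))) :
    IsPrimitive F f := by
  have h := (hre.ofReal (𝕜 := 𝕜)).add ((him.ofReal (𝕜 := 𝕜)).const_mul RCLike.I)
  refine (h.congr fun x _ => ?_).congr_density fun x _ => ?_ <;>
  · rw [mul_comm]
    exact RCLike.re_add_im _

theorem absolutelyContinuousOnInterval_and_ae_deriv_eq {F f : ℝ → ℝ} (hF : IsPrimitive F f)
    {x : ℝ} (hx : 0 ≤ x) :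
    AbsolutelyContinuousOnInterval (fun x => F 0 + ∫ t in (0 : ℝ)..x, f t) 0 x ∧
      ∀ᵐ y, y ∈ Set.uIcc 0 x → deriv (fun x => F 0 + ∫ t in (0 : ℝ)..x, f t) y = f y := by
  constructor
  · exact (LipschitzOnWith.absolutelyContinuousOnInterval
      (LipschitzWith.const (F 0)).lipschitzOnWith).add
        ((hF.intervalIntegrable x hx).absolutelyContinuousOnInterval_intervalIntegral
          Set.left_mem_uIcc)
  · filter_upwards [(hF.intervalIntegrable x hx).ae_hasDerivAt_integral] with y hy hyx
    exact ((hy hyx 0 Set.left_mem_uIcc).const_add (F 0)).deriv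

theorem mul_real {F f G g : ℝ → ℝ} (hF : IsPrimitive F f) (hG : IsPrimitive G g) :
    IsPrimitive (fun x => F x * G x) (fun x => f x * G x + F x * g x) where
  intervalIntegrable x hx :=
    ((hF.intervalIntegrable x hx).mul_continuousOn (hG.continuousOn_uIcc hx)).add
      ((hG.intervalIntegrable x hx).continuousOn_mul (hF.continuousOn_uIcc hx))
  eq x hx := by
    obtain ⟨hFac, hF'⟩ := hF.absolutelyContinuousOnInterval_and_ae_deriv_eq hx
    obtain ⟨hGac, hG'⟩ := hG.absolutelyContinuousOnInterval_and_ae_deriv_eq hx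
    have hparts := hFac.integral_deriv_mul_eq_sub hGac
    rw [← hF.eq x hx, ← hG.eq x hx] at hparts
    simp only [intervalIntegral.integral_same, add_zero] at hparts
    rw [← sub_eq_iff_eq_add', ← hparts]
    refine intervalIntegral.integral_congr_ae ?_
    filter_upwards [hF', hG'] with y hFy hGy hy
    have hy' := Set.uIoc_subset_uIcc hy
    rw [hFy hy', hGy hy']
    rw [Set.uIcc_of_le hx] at hy'
    rw [← hF.eq y hy'.1, ← hG.eq y hy'.1]

theorem mul (hF : IsPrimitive F f) (hG : IsPrimitive G g) :
    IsPrimitive (fun x => F x * G x) (fun x => f x * G x + F x * g x) := by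
  refine of_re_im ?_ ?_
  · refine (((hF.re.mul_real hG.re).sub (hF.im.mul_real hG.im)).congr fun x _ => ?_).congr_density
      fun x _ => ?_
    · simp only [RCLike.mul_re]
    · simp only [RCLike.mul_re, map_add]
      ring
  · refine (((hF.re.mul_real hG.im).add (hF.im.mul_real hG.re)).congr fun x _ => ?_).congr_density
      fun x _ => ?_
    · simp only [RCLike.mul_im]
    · simp only [RCLike.mul_im, map_add]
      ring

end RCLike

end IsPrimitive

/-! ### Linear differential equations with a parameter -/

section LinearODE

variable {X E : Type*} [NormedAddCommGroup E] [NormedSpace ℝ E]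

/-- The terms of the Picard series of `Y' = A Y`, `Y 0 = e`, where `A` depends on a parameter. -/
noncomputable def picardTerm (A : X → ℝ → E →L[ℝ] E) (e : E) : ℕ → X → ℝ → E
  | 0, _, _ => e
  | n + 1, p, x => ∫ t in (0 : ℝ)..x, A p t (picardTerm A e n p t)

/-- The sum of the Picard series of `Y' = A Y`, `Y 0 = e`. It solves the equation on `[0, ∞)`; on
the negative half-line it is continued by `e`. -/
noncomputable def picardSum (A : X → ℝ → E →L[ℝ] E) (e : E) (p : X) (x : ℝ) : E :=
  ∑' n, picardTerm A e n p (max x 0)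

variable {A : X → ℝ → E →L[ℝ] E} {e : E}

theorem norm_picardTerm_le {p : X} {R C : ℝ} (hC : ∀ t ∈ Set.Icc 0 R, ‖A p t‖ ≤ C) (n : ℕ) :
    ∀ x ∈ Set.Icc 0 R, ‖picardTerm A e n p x‖ ≤ ‖e‖ * ((C * x) ^ n / n.factorial) := by
  induction n with
  | zero => simp [picardTerm]
  | succ n ih =>
    intro x hx
    have hbound : ∀ t ∈ Set.Ioc 0 x, ‖A p t (picardTerm A e n p t)‖ ≤
        C ^ (n + 1) * ‖e‖ / n.factorial * t ^ n := fun t ht => by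
      have ht' : t ∈ Set.Icc 0 R := ⟨ht.1.le, ht.2.trans hx.2⟩
      calc ‖A p t (picardTerm A e n p t)‖
        _ ≤ C * (‖e‖ * ((C * t) ^ n / n.factorial)) :=
          (A p t).le_of_opNorm_le_of_le (hC t ht') (ih t ht')
        _ = C ^ (n + 1) * ‖e‖ / n.factorial * t ^ n := by ring
    calc ‖picardTerm A e (n + 1) p x‖
      _ ≤ ∫ t in (0 : ℝ)..x, C ^ (n + 1) * ‖e‖ / n.factorial * t ^ n :=
        intervalIntegral.norm_integral_le_of_norm_le hx.1 (.of_forall hbound)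
          (Continuous.intervalIntegrable (by fun_prop) _ _)
      _ = ‖e‖ * ((C * x) ^ (n + 1) / (n + 1).factorial) := by
        rw [intervalIntegral.integral_const_mul, integral_pow, zero_pow n.succ_ne_zero,
          Nat.factorial_succ]
        push_cast
        field_simp
        ring

theorem norm_picardTerm_max_le {p : X} {R C : ℝ} (hR : 0 ≤ R)
    (hC : ∀ t ∈ Set.Icc 0 R, ‖A p t‖ ≤ C) (n : ℕ) {x : ℝ} (hx : x ≤ R) :
    ‖picardTerm A e n p (max x 0)‖ ≤ ‖e‖ * ((C * R) ^ n / n.factorial) := by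
  have hmem : max x 0 ∈ Set.Icc 0 R := ⟨le_max_right _ _, max_le hx hR⟩
  have hC0 : 0 ≤ C := (norm_nonneg _).trans (hC 0 ⟨le_rfl, hR⟩)
  refine (norm_picardTerm_le hC n _ hmem).trans ?_
  have := hmem.1
  have := hmem.2
  gcongr

theorem picardSum_zero (p : X) : picardSum A e p 0 = e := by
  rw [picardSum, max_self, tsum_eq_single 0]
  · rfl
  · rintro (_ | n) hn
    · exact absurd rfl hn
    · exact intervalIntegral.integral_same

variable [TopologicalSpace X]

theorem continuous_picardTerm (hA : Continuous (Function.uncurry A)) (n : ℕ) :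
    Continuous (Function.uncurry (picardTerm A e n)) := by
  induction n with
  | zero => exact continuous_const
  | succ n ih =>
    have h : Continuous (Function.uncurry fun p t => A p t (picardTerm A e n p t)) :=
      hA.clm_apply ih
    exact intervalIntegral.continuous_parametric_primitive_of_continuous h

theorem continuous_picardTerm_max (hA : Continuous (Function.uncurry A)) (n : ℕ) :
    Continuous fun a : X × ℝ => picardTerm A e n a.1 (max a.2 0) :=
  (continuous_picardTerm hA n).comp
    (continuous_fst.prodMk (continuous_snd.max continuous_const))

variable [CompleteSpace E]

theorem hasSum_integral_picardTerm (hA : Continuous (Function.uncurry A)) (p : X) {x : ℝ}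
    (hx : 0 ≤ x) :
    HasSum (fun n => picardTerm A e (n + 1) p x)
      (∫ t in (0 : ℝ)..x, A p t (picardSum A e p t)) := by
  have hAp : Continuous fun t => A p t := hA.comp (by fun_prop : Continuous fun t => (p, t))
  obtain ⟨C, hC⟩ := (isCompact_Icc (a := 0) (b := x)).exists_bound_of_continuousOn hAp.continuousOn
  have hsum := (Real.summable_pow_div_factorial (C * x)).mul_left ‖e‖
  have hterm (n : ℕ) : picardTerm A e (n + 1) p x =
      ∫ t in (0 : ℝ)..x, A p t (picardTerm A e n p (max t 0)) :=
    intervalIntegral.integral_congr fun t ht => by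
      rw [Set.uIcc_of_le hx] at ht
      simp only [max_eq_left ht.1]
  simp only [hterm]
  refine intervalIntegral.hasSum_integral_of_dominated_convergence
    (fun n _ => C * (‖e‖ * ((C * x) ^ n / n.factorial))) (fun n => ?_)
    (fun n => .of_forall fun t ht => ?_) (.of_forall fun _ _ => hsum.mul_left C)
    intervalIntegrable_const (.of_forall fun t ht => ?_)
  · exact (hAp.clm_apply ((continuous_picardTerm_max hA n).comp
      (by fun_prop : Continuous fun t => (p, t)))).aestronglyMeasurable
  · rw [Set.uIoc_of_le hx] at ht
    exact (A p t).le_of_opNorm_le_of_le (hC t ⟨ht.1.le, ht.2⟩) (norm_picardTerm_max_le hx hC n ht.2)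
  · rw [Set.uIoc_of_le hx] at ht
    exact (A p t).hasSum
      (Summable.of_norm_bounded hsum fun n => norm_picardTerm_max_le hx hC n ht.2).hasSum

variable [LocallyCompactSpace X]

theorem continuous_picardSum (hA : Continuous (Function.uncurry A)) :
    Continuous (Function.uncurry (picardSum A e)) := by
  rw [continuous_iff_continuousAt]
  rintro ⟨p, x⟩
  obtain ⟨K, hK, hpK⟩ := exists_compact_mem_nhds p
  obtain ⟨C, hC⟩ := (hK.prod (isCompact_Icc (a := 0) (b := |x| + 1))).exists_bound_of_continuousOn
    hA.continuousOn
  refine (continuousOn_tsum (fun n => (continuous_picardTerm_max hA n).continuousOn)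
    ((Real.summable_pow_div_factorial (C * (|x| + 1))).mul_left ‖e‖)
    fun n a (ha : a ∈ K ×ˢ Set.Iic (|x| + 1)) => ?_).continuousAt
      (prod_mem_nhds hpK (Iic_mem_nhds (by linarith [le_abs_self x])))
  exact norm_picardTerm_max_le (by positivity) (fun t ht => hC (a.1, t) ⟨ha.1, ht⟩) n ha.2

theorem isPrimitive_picardSum (hA : Continuous (Function.uncurry A)) (p : X) :
    IsPrimitive (picardSum A e p) fun t => A p t (picardSum A e p t) := by
  have hp : Continuous fun t : ℝ => (p, t) := by fun_prop
  have hsum {x : ℝ} (hx : 0 ≤ x) :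
      picardSum A e p x = e + ∫ t in (0 : ℝ)..x, A p t (picardSum A e p t) := by
    rw [picardSum, max_eq_left hx]
    have h := hasSum_integral_picardTerm (e := e) hA p hx
    exact ((hasSum_nat_add_iff' 1).1 (by simpa [picardTerm] using h)).tsum_eq
  refine .of_continuousOn ((hA.comp hp).clm_apply
    ((continuous_picardSum hA).comp hp)).continuousOn fun x hx => ?_
  rw [hsum hx, hsum le_rfl, intervalIntegral.integral_same, add_zero]

end LinearODE

/-! ### Solutions of Hill's equation -/

theorem intervalIntegrable_of_locallyIntegrable {E : Type*} [NormedAddCommGroup E] {f : ℝ → E}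
    {ν : Measure ℝ} (hf : LocallyIntegrable f ν) (a b : ℝ) : IntervalIntegrable f ν a b :=
  (hf.integrableOn_isCompact isCompact_uIcc).intervalIntegrable

namespace IsHillSolution

variable {𝕜 : Type*} [RCLike 𝕜] {q : ℝ → ℝ} {z z' : 𝕜} {y dy w dw : ℝ → 𝕜}

theorem isPrimitive (h : IsHillSolution q z y dy) : IsPrimitive y dy :=
  .of_continuousOn h.continuousOn_deriv h.eq

theorem isPrimitive_deriv (hq : LocallyIntegrable q volume) (h : IsHillSolution q z y dy) :
    IsPrimitive dy (fun t => ((q t : 𝕜) - z) * y t) where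
  intervalIntegrable x hx := by
    refine IntervalIntegrable.mul_continuousOn ?_ (h.isPrimitive.continuousOn_uIcc hx)
    refine IntervalIntegrable.sub ?_ intervalIntegrable_const
    exact intervalIntegrable_iff.2 ((RCLike.ofRealCLM (K := 𝕜)).integrable_comp
      (intervalIntegrable_iff.1 (intervalIntegrable_of_locallyIntegrable hq 0 x)))
  eq := h.deriv_eq

theorem of_isPrimitive (h : IsPrimitive y dy)
    (h' : IsPrimitive dy (fun t => ((q t : 𝕜) - z) * y t)) : IsHillSolution q z y dy where
  continuousOn := h.continuousOn
  continuousOn_deriv := h'.continuousOn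
  eq := h.eq
  deriv_eq := h'.eq

theorem initial_eq_zero {ℓ : ℝ} (hℓ : 0 < ℓ) (h : IsHillSolution q z y dy)
    (hy : ∀ x ∈ Set.Icc 0 ℓ, y x = 0) : y 0 = 0 ∧ dy 0 = 0 := by
  have hdy : ∀ x ∈ Set.Icc 0 ℓ, dy x = dy 0 := fun x hx => by
    rw [h.deriv_eq x hx.1, intervalIntegral.integral_congr (g := fun _ => 0)]
    · simp
    · intro t ht
      rw [Set.uIcc_of_le hx.1] at ht
      simp [hy t ⟨ht.1, ht.2.trans hx.2⟩]
  refine ⟨hy 0 ⟨le_rfl, hℓ.le⟩, ?_⟩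
  have hintegral := h.eq ℓ hℓ.le
  rw [hy ℓ ⟨hℓ.le, le_rfl⟩, hy 0 ⟨le_rfl, hℓ.le⟩,
    intervalIntegral.integral_congr (g := fun _ => dy 0)] at hintegral
  · simpa [hℓ.ne'] using hintegral.symm
  · intro t ht
    rw [Set.uIcc_of_le hℓ.le] at ht
    exact hdy t ht

theorem integral_norm_sq_pos {ℓ : ℝ} (hℓ : 0 < ℓ) (h : IsHillSolution q z y dy)
    (h0 : ¬(y 0 = 0 ∧ dy 0 = 0)) : 0 < ∫ t in (0 : ℝ)..ℓ, ‖y t‖ ^ 2 := by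
  have hcont : ContinuousOn (fun t => ‖y t‖ ^ 2) (Set.Icc 0 ℓ) :=
    (h.continuousOn.mono Set.Icc_subset_Ici_self).norm.pow 2
  obtain ⟨c, hc, hyc⟩ : ∃ c ∈ Set.Icc 0 ℓ, y c ≠ 0 := by
    by_contra! hzero
    exact h0 (h.initial_eq_zero hℓ hzero)
  exact intervalIntegral.integral_pos hℓ hcont (fun _ _ => by positivity) ⟨c, hc, by positivity⟩

variable (hq : LocallyIntegrable q volume)
include hq

theorem linear_comb (h : IsHillSolution q z y dy) (h' : IsHillSolution q z w dw) (a b : 𝕜) :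
    IsHillSolution q z (fun x => a * y x + b * w x) (fun x => a * dy x + b * dw x) := by
  refine of_isPrimitive ((h.isPrimitive.const_mul a).add (h'.isPrimitive.const_mul b)) ?_
  refine (((h.isPrimitive_deriv hq).const_mul a).add
    ((h'.isPrimitive_deriv hq).const_mul b)).congr_density fun x _ => ?_
  ring

theorem ofReal {z : ℝ} {y dy : ℝ → ℝ} (h : IsHillSolution q z y dy) :
    IsHillSolution q (z : 𝕜) (fun x => (y x : 𝕜)) (fun x => (dy x : 𝕜)) := by
  refine of_isPrimitive h.isPrimitive.ofReal ?_
  refine (h.isPrimitive_deriv hq).ofReal.congr_density fun x _ => ?_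
  push_cast
  rfl

theorem comp_add_period {ℓ : ℝ} (hℓ : 0 ≤ ℓ) (hper : Function.Periodic q ℓ)
    (h : IsHillSolution q z y dy) :
    IsHillSolution q z (fun x => y (x + ℓ)) (fun x => dy (x + ℓ)) := by
  refine of_isPrimitive (h.isPrimitive.comp_add_right hℓ) ?_
  refine ((h.isPrimitive_deriv hq).comp_add_right hℓ).congr_density fun x _ => ?_
  rw [hper x]

theorem isPrimitive_wronskian (h : IsHillSolution q z y dy) (h' : IsHillSolution q z' w dw) :
    IsPrimitive (fun x => y x * dw x - w x * dy x) (fun x => (z - z') * (y x * w x)) := by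
  refine ((h.isPrimitive.mul (h'.isPrimitive_deriv hq)).sub
    (h'.isPrimitive.mul (h.isPrimitive_deriv hq))).congr_density fun x _ => ?_
  ring

theorem wronskian_eq (h : IsHillSolution q z y dy) (h' : IsHillSolution q z w dw) {x : ℝ}
    (hx : 0 ≤ x) : y x * dw x - w x * dy x = y 0 * dw 0 - w 0 * dy 0 :=
  (h.isPrimitive_wronskian hq h').eq_of_density_eq_zero (fun _ _ => by ring) hx

end IsHillSolution

section Existence

variable (𝕜 : Type*) [RCLike 𝕜] {q : ℝ → ℝ}

/-- The coefficient matrix of Hill's equation as a system for `(y, y' - S y)`. The quasi-derivative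
`y' - S y`, where `S' = q`, makes it continuous although `q` is only locally integrable. -/
noncomputable def quasiDerivativeMatrix (S : ℝ → 𝕜) (z : 𝕜) (t : ℝ) : 𝕜 × 𝕜 →L[ℝ] 𝕜 × 𝕜 :=
  letI mul : 𝕜 → 𝕜 →L[ℝ] 𝕜 := ContinuousLinearMap.mul ℝ 𝕜
  letI fst := ContinuousLinearMap.fst ℝ 𝕜 𝕜
  letI snd := ContinuousLinearMap.snd ℝ 𝕜 𝕜
  ((mul (S t)).comp fst + snd).prod (-((mul (z + S t ^ 2)).comp fst + (mul (S t)).comp snd))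

variable {𝕜}

theorem continuous_quasiDerivativeMatrix {S : ℝ → 𝕜} (hS : Continuous S) :
    Continuous (Function.uncurry (quasiDerivativeMatrix 𝕜 S)) := by
  have hmul := (ContinuousLinearMap.mul ℝ 𝕜).continuous
  have hSt : Continuous fun p : 𝕜 × ℝ => ContinuousLinearMap.mul ℝ 𝕜 (S p.2) :=
    hmul.comp (hS.comp continuous_snd)
  have hzSt : Continuous fun p : 𝕜 × ℝ => ContinuousLinearMap.mul ℝ 𝕜 (p.1 + S p.2 ^ 2) :=
    hmul.comp (continuous_fst.add ((hS.comp continuous_snd).pow 2))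
  exact (ContinuousLinearMap.prodₗᵢ ℝ).continuous.comp
    (((hSt.clm_comp continuous_const).add continuous_const).prodMk
      ((hzSt.clm_comp continuous_const).add (hSt.clm_comp continuous_const)).neg)

theorem exists_isHillSolution (hq : LocallyIntegrable q volume) (a b : 𝕜) :
    ∃ y dy : 𝕜 → ℝ → 𝕜, Continuous (Function.uncurry y) ∧ Continuous (Function.uncurry dy) ∧
      ∀ z, IsHillSolution q z (y z) (dy z) ∧ y z 0 = a ∧ dy z 0 = b := by
  set S : ℝ → 𝕜 := fun x => ((∫ t in (0 : ℝ)..x, q t : ℝ) : 𝕜) with hS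
  have hScont : Continuous S := RCLike.continuous_ofReal.comp
    (intervalIntegral.continuous_primitive (intervalIntegrable_of_locallyIntegrable hq) 0)
  have hSprim : IsPrimitive S fun t => (q t : 𝕜) :=
    IsPrimitive.ofReal (F := fun x => ∫ t in (0 : ℝ)..x, q t) (f := q)
      ⟨fun x _ => intervalIntegrable_of_locallyIntegrable hq 0 x, fun x _ => by simp⟩
  have hS0 : S 0 = 0 := by simp [hS]
  have hA := continuous_quasiDerivativeMatrix hScont
  set Y := picardSum (quasiDerivativeMatrix 𝕜 S) (a, b)
  have hY : Continuous (Function.uncurry Y) := continuous_picardSum hA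
  have hYprim (z : 𝕜) : IsPrimitive (Y z) fun t =>
      (S t * (Y z t).1 + (Y z t).2, -((z + S t ^ 2) * (Y z t).1 + S t * (Y z t).2)) :=
    isPrimitive_picardSum hA z
  have hY0 (z : 𝕜) : Y z 0 = (a, b) := picardSum_zero z
  refine ⟨fun z x => (Y z x).1, fun z x => S x * (Y z x).1 + (Y z x).2, hY.fst,
    ((hScont.comp continuous_snd).mul hY.fst).add hY.snd, fun z => ⟨?_, ?_, ?_⟩⟩
  · have hy := (hYprim z).clm_comp (ContinuousLinearMap.fst ℝ 𝕜 𝕜)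
    have hw := (hYprim z).clm_comp (ContinuousLinearMap.snd ℝ 𝕜 𝕜)
    refine .of_isPrimitive hy (((hSprim.mul hy).add hw).congr_density fun x _ => ?_)
    simp only [ContinuousLinearMap.coe_fst', ContinuousLinearMap.coe_snd']
    ring
  · simp only [hY0]
  · simp only [hY0, hS0, zero_mul, zero_add]

end Existence

/-- The solutions `u`, `v` of Hill's equation with `u 0 = v' 0 = 1` and `u' 0 = v 0 = 0`, for every
value of the spectral parameter, with their derivatives. -/
structure FundamentalSystem (𝕜 : Type*) [RCLike 𝕜] (q : ℝ → ℝ) where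
  locallyIntegrable : LocallyIntegrable q volume
  (u du v dv : 𝕜 → ℝ → 𝕜)
  continuous_u : Continuous (Function.uncurry u)
  continuous_du : Continuous (Function.uncurry du)
  continuous_v : Continuous (Function.uncurry v)
  continuous_dv : Continuous (Function.uncurry dv)
  solution_u : ∀ z, IsHillSolution q z (u z) (du z)
  solution_v : ∀ z, IsHillSolution q z (v z) (dv z)
  u_zero : ∀ z, u z 0 = 1
  du_zero : ∀ z, du z 0 = 0
  v_zero : ∀ z, v z 0 = 0
  dv_zero : ∀ z, dv z 0 = 1

namespace FundamentalSystem

variable {𝕜 : Type*} [RCLike 𝕜] {q : ℝ → ℝ} {z : 𝕜} {y dy : ℝ → 𝕜}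

theorem nonempty (hq : LocallyIntegrable q volume) : Nonempty (FundamentalSystem 𝕜 q) := by
  obtain ⟨u, du, hu, hdu, hu'⟩ := exists_isHillSolution hq (1 : 𝕜) 0
  obtain ⟨v, dv, hv, hdv, hv'⟩ := exists_isHillSolution hq (0 : 𝕜) 1
  exact ⟨⟨hq, u, du, v, dv, hu, hdu, hv, hdv, fun z => (hu' z).1, fun z => (hv' z).1,
    fun z => (hu' z).2.1, fun z => (hu' z).2.2, fun z => (hv' z).2.1, fun z => (hv' z).2.2⟩⟩

variable (S : FundamentalSystem 𝕜 q)

theorem wronskian (z : 𝕜) {x : ℝ} (hx : 0 ≤ x) :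
    S.u z x * S.dv z x - S.v z x * S.du z x = 1 := by
  rw [(S.solution_u z).wronskian_eq S.locallyIntegrable (S.solution_v z) hx, S.u_zero, S.dv_zero,
    S.v_zero]
  ring

theorem eq_comb (h : IsHillSolution q z y dy) {x : ℝ} (hx : 0 ≤ x) :
    y x = y 0 * S.u z x + dy 0 * S.v z x ∧ dy x = y 0 * S.du z x + dy 0 * S.dv z x := by
  have hu := h.wronskian_eq S.locallyIntegrable (S.solution_u z) hx
  have hv := h.wronskian_eq S.locallyIntegrable (S.solution_v z) hx
  have hw := S.wronskian z hx
  rw [S.u_zero, S.du_zero] at hu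
  rw [S.v_zero, S.dv_zero] at hv
  constructor
  · linear_combination S.u z x * hv - S.v z x * hu - y x * hw
  · linear_combination S.du z x * hv - S.dv z x * hu - dy x * hw

end FundamentalSystem

theorem IsHillSolution.eq_of_initial_eq {𝕜 : Type*} [RCLike 𝕜] {q : ℝ → ℝ} {z : 𝕜}
    {y dy w dw : ℝ → 𝕜} (hq : LocallyIntegrable q volume) (h : IsHillSolution q z y dy)
    (h' : IsHillSolution q z w dw) (h0 : y 0 = w 0) (h1 : dy 0 = dw 0) {x : ℝ} (hx : 0 ≤ x) :
    y x = w x ∧ dy x = dw x := by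
  obtain ⟨S⟩ := FundamentalSystem.nonempty (𝕜 := 𝕜) hq
  rw [(S.eq_comb h hx).1, (S.eq_comb h hx).2, (S.eq_comb h' hx).1, (S.eq_comb h' hx).2, h0, h1]
  exact ⟨rfl, rfl⟩

/-! ### Counting eigenvalues by means of the discriminant -/

theorem eventually_nhdsNE_eq_of_locally_const {X α : Type*} [TopologicalSpace X] [T1Space X]
    [PreconnectedSpace X] [∀ x : X, (𝓝[≠] x).NeBot] {H : X → α}
    (hH : ∀ x, ∃ c, ∀ᶠ y in 𝓝[≠] x, H y = c) {c : α} {x₀ : X} (hc : ∀ᶠ y in 𝓝[≠] x₀, H y = c)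
    (x : X) : ∀ᶠ y in 𝓝[≠] x, H y = c := by
  have hnear {x : X} {p : X → Prop} (h : ∀ᶠ y in 𝓝[≠] x, p y) :
      ∀ᶠ z in 𝓝 x, ∀ᶠ y in 𝓝[≠] z, p y := by
    have h' : ∀ᶠ z in 𝓝[≠] x, ∀ᶠ y in 𝓝[≠] z, p y :=
      (eventually_nhdsNE_eventually_nhds_iff.2 h).mono fun z hz => hz.filter_mono inf_le_left
    filter_upwards [eventually_nhdsWithin_iff.1 h'] with z hz
    by_cases hzx : z = x
    · rwa [hzx]
    · exact hz hzx
  suffices hclopen : IsClopen {x | ∀ᶠ y in 𝓝[≠] x, H y = c} from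
    (hclopen.eq_univ ⟨x₀, hc⟩).ge (Set.mem_univ x)
  refine ⟨⟨isOpen_iff_mem_nhds.2 fun x hx => ?_⟩, isOpen_iff_mem_nhds.2 fun x hx => hnear hx⟩
  obtain ⟨d, hd⟩ := hH x
  have hdc : d ≠ c := fun hdc => hx (hdc ▸ hd)
  filter_upwards [hnear hd] with z hz hzc
  obtain ⟨y, hyd, hyc⟩ := (hz.and hzc).exists
  exact hdc (hyd.symm.trans hyc)

section Counting

variable {ι : Type*} {e : ι → ℝ} {x : ℝ}

theorem eventually_nhdsLT_setOf_lt_eq (h : ∀ᶠ w in 𝓝[≠] x, ∀ i, e i ≠ w) :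
    ∀ᶠ y in 𝓝[<] x, {i | e i < y} = {i | e i < x} := by
  obtain ⟨a, ha, hax⟩ := mem_nhdsLT_iff_exists_Ioo_subset.1 (h.filter_mono (nhdsLT_le_nhdsNE x))
  filter_upwards [Ioo_mem_nhdsLT ha] with y hy
  ext i
  refine ⟨fun hi => hi.trans hy.2, fun (hi : e i < x) => ?_⟩
  by_contra hyi
  exact hax ⟨hy.1.trans_le (not_lt.1 hyi), hi⟩ i rfl

theorem eventually_nhdsGT_setOf_lt_eq (h : ∀ᶠ w in 𝓝[≠] x, ∀ i, e i ≠ w) :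
    ∀ᶠ y in 𝓝[>] x, {i | e i < y} = {i | e i ≤ x} := by
  obtain ⟨b, hb, hxb⟩ := mem_nhdsGT_iff_exists_Ioo_subset.1 (h.filter_mono (nhdsGT_le_nhdsNE x))
  filter_upwards [Ioo_mem_nhdsGT hb] with y hy
  ext i
  refine ⟨fun (hi : e i < y) => ?_, fun hi => lt_of_le_of_lt hi hy.1⟩
  by_contra! hxi
  exact hxb ⟨not_le.1 hxi, hi.trans hy.2⟩ i rfl

variable {m : ℝ → ℕ}

theorem ne_of_multiplicity_eq_zero (he : ∀ μ, {i | e i = μ}.encard = m μ) {μ : ℝ} (hμ : m μ = 0)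
    (i : ι) : e i ≠ μ := fun hi => by
  have h := he μ
  rw [hμ, Nat.cast_zero, Set.encard_eq_zero] at h
  exact h.le hi

theorem finite_setOf_le_iff (he : ∀ μ, {i | e i = μ}.encard = m μ) (x : ℝ) :
    {i | e i ≤ x}.Finite ↔ {i | e i < x}.Finite := by
  have hfin : {i | e i = x}.Finite := Set.finite_of_encard_eq_coe (he x)
  simp only [le_iff_lt_or_eq, Set.ofPred_or, Set.finite_union, hfin, and_true]

theorem ncard_setOf_le (he : ∀ μ, {i | e i = μ}.encard = m μ) (hfin : {i | e i < x}.Finite) :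
    {i | e i ≤ x}.ncard = {i | e i < x}.ncard + m x := by
  have hdisj : Disjoint {i | e i < x} {i | e i = x} :=
    Set.disjoint_left.2 fun _ hlt heq => (ne_of_lt hlt) heq
  simp only [le_iff_lt_or_eq, Set.ofPred_or]
  rw [Set.ncard_union_eq hdisj hfin (Set.finite_of_encard_eq_coe (he x)), Set.ncard, Set.ncard,
    he x, ENat.toNat_natCast]

theorem setOf_lt_eq_empty (he : ∀ μ, {i | e i = μ}.encard = m μ) {x₀ : ℝ}
    (hm : ∀ x ≤ x₀, m x = 0) (hx : x ≤ x₀) : {i | e i < x} = ∅ :=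
  Set.eq_empty_of_forall_notMem fun i hi =>
    ne_of_multiplicity_eq_zero he (hm _ (le_of_lt (lt_of_lt_of_le hi hx))) i rfl

theorem finite_setOf_lt (he : ∀ μ, {i | e i = μ}.encard = m μ)
    (hisol : ∀ x, ∀ᶠ w in 𝓝[≠] x, m w = 0) {x₀ : ℝ} (hm : ∀ x ≤ x₀, m x = 0) (x : ℝ) :
    {i | e i < x}.Finite := by
  have hne (x : ℝ) : ∀ᶠ w in 𝓝[≠] x, ∀ i, e i ≠ w :=
    (hisol x).mono fun w hw => ne_of_multiplicity_eq_zero he hw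
  have hlocal (x : ℝ) : ∀ᶠ y in 𝓝[≠] x, {i | e i < y}.Finite = {i | e i < x}.Finite := by
    rw [← nhdsLT_sup_nhdsGT]
    refine eventually_sup.2 ⟨?_, ?_⟩
    · filter_upwards [eventually_nhdsLT_setOf_lt_eq (hne x)] with y hy
      rw [hy]
    · filter_upwards [eventually_nhdsGT_setOf_lt_eq (hne x)] with y hy
      rw [hy, finite_setOf_le_iff he]
  have hleft : ∀ᶠ y in 𝓝[≠] (x₀ - 1), {i | e i < y}.Finite = True := by
    filter_upwards [nhdsWithin_le_nhds (Iio_mem_nhds (sub_one_lt x₀))] with y hy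
    rw [setOf_lt_eq_empty he hm (le_of_lt hy)]
    exact eq_true Set.finite_empty
  obtain ⟨y, hyx, hy⟩ := ((hlocal x).and (eventually_nhdsNE_eq_of_locally_const
    (fun x => ⟨_, hlocal x⟩) hleft x)).exists
  exact of_eq_true (hyx.symm.trans hy)

theorem ncard_lt_ncard_of_mem_Ioo {e f : ℕ → ℝ} (he : Monotone e) (hf : Monotone f) {n : ℕ} {x : ℝ}
    (hfin : {i | e i < x}.Finite) (hx : x ∈ Set.Ioo (e n) (f n)) :
    {i | f i < x}.ncard < {i | e i < x}.ncard :=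
  calc {i | f i < x}.ncard
    _ ≤ (Set.Iio n).ncard := Set.ncard_le_ncard
      (fun _ hi => not_le.1 fun hni => (hi.trans hx.2).not_ge (hf hni)) (Set.finite_Iio n)
    _ < (Set.Iic n).ncard := Set.ncard_lt_ncard Set.Iio_ssubset_Iic_self (Set.finite_Iic n)
    _ ≤ {i | e i < x}.ncard := Set.ncard_le_ncard (fun _ hi => (he hi).trans_lt hx.1) hfin

end Counting

theorem deriv_pos_of_lt_right {f f' : ℝ → ℝ} {a b : ℝ}
    (hf : ∀ x ∈ Set.Ioc a b, HasDerivAt f (f' x) x) (hf' : ∀ x ∈ Set.Ioo a b, f' x ≠ 0)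
    (hlt : ∀ x ∈ Set.Ioo a b, f x < f b) {x : ℝ} (hx : x ∈ Set.Ioo a b) : 0 < f' x := by
  obtain ⟨c, hc, hslope⟩ := exists_hasDerivAt_eq_slope f f' hx.2
    (fun y hy => (hf y ⟨hx.1.trans_le hy.1, hy.2⟩).continuousAt.continuousWithinAt)
    fun y hy => hf y ⟨hx.1.trans hy.1, hy.2.le⟩
  have hcpos : 0 < f' c := hslope ▸ div_pos (sub_pos.2 (hlt x hx)) (sub_pos.2 hx.2)
  rcases hasDerivWithinAt_forall_lt_or_forall_gt_of_forall_ne (convex_Ioo a b)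
    (fun y hy => (hf y ⟨hy.1, hy.2.le⟩).hasDerivWithinAt) hf' with hneg | hpos
  · exact absurd (hneg c ⟨hx.1.trans hc.1, hc.2⟩) hcpos.not_gt
  · exact hpos x hx

theorem deriv_neg_of_lt_left {f f' : ℝ → ℝ} {a b : ℝ}
    (hf : ∀ x ∈ Set.Ico a b, HasDerivAt f (f' x) x) (hf' : ∀ x ∈ Set.Ioo a b, f' x ≠ 0)
    (hlt : ∀ x ∈ Set.Ioo a b, f x < f a) {x : ℝ} (hx : x ∈ Set.Ioo a b) : f' x < 0 := by
  have hmem {y : ℝ} (hy : y ∈ Set.Ioo (-b) (-a)) : -y ∈ Set.Ioo a b :=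
    ⟨lt_neg.2 hy.2, neg_lt.2 hy.1⟩
  have h := deriv_pos_of_lt_right (f := fun y => f (-y)) (f' := fun y => -f' (-y))
    (a := -b) (b := -a) (fun y hy => ?_) (fun y hy => neg_ne_zero.2 (hf' _ (hmem hy)))
    (fun y hy => by simpa using hlt _ (hmem hy)) (x := -x) ⟨neg_lt_neg hx.2, neg_lt_neg hx.1⟩
  · simpa using h
  · exact ((hf (-y) ⟨le_neg.2 hy.2, neg_lt.2 hy.1⟩).comp y (hasDerivAt_neg' y)).congr_deriv
      (mul_neg_one _)

/-- `D` behaves like the discriminant of Hill's equation, with derivative `D'`, when `mp x` and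
`mm x` are the multiplicities of `x` as a periodic and as a semi-periodic eigenvalue. -/
structure IsDiscriminant (D D' : ℝ → ℝ) (mp mm : ℝ → ℕ) : Prop where
  hasDerivAt : ∀ x, HasDerivAt D (D' x) x
  deriv_ne_zero : ∀ x, D x ^ 2 < 4 → D' x ≠ 0
  mp_eq_zero : ∀ x, D x ≠ 2 → mp x = 0
  mm_eq_zero : ∀ x, D x ≠ -2 → mm x = 0
  mp_cases : ∀ x, D x = 2 → mp x = 1 ∧ D' x ≠ 0 ∨ mp x = 2 ∧ ∀ᶠ y in 𝓝[≠] x, D y ^ 2 < 4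
  mm_cases : ∀ x, D x = -2 → mm x = 1 ∧ D' x ≠ 0 ∨ mm x = 2 ∧ ∀ᶠ y in 𝓝[≠] x, D y ^ 2 < 4

/-- The number of periodic minus the number of semi-periodic eigenvalues below `x`, read off the
discriminant: `0` in an instability interval, and in a stability interval `1` or `-1` according as
the discriminant decreases or increases. -/
noncomputable def bandIndex (D D' : ℝ → ℝ) (x : ℝ) : ℤ :=
  open Classical in if D x ^ 2 < 4 then -(SignType.sign (D' x) : ℤ) else 0

theorem bandIndex_of_sq_lt {D D' : ℝ → ℝ} {x : ℝ} (hx : D x ^ 2 < 4) :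
    bandIndex D D' x = -(SignType.sign (D' x) : ℤ) := if_pos hx

theorem bandIndex_of_le_sq {D D' : ℝ → ℝ} {x : ℝ} (hx : 4 ≤ D x ^ 2) : bandIndex D D' x = 0 :=
  if_neg hx.not_gt

theorem bandIndex_neg (D D' : ℝ → ℝ) (x : ℝ) :
    bandIndex (-D) (-D') x = -bandIndex D D' x := by
  by_cases hx : D x ^ 2 < 4
  · rw [bandIndex_of_sq_lt hx, bandIndex_of_sq_lt (by simpa using hx), Pi.neg_apply, Left.sign_neg,
      SignType.coe_neg]
  · rw [bandIndex_of_le_sq (not_lt.1 hx), bandIndex_of_le_sq (by simpa using hx), neg_zero]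

namespace IsDiscriminant

variable {D D' : ℝ → ℝ} {mp mm : ℝ → ℕ}

theorem neg (h : IsDiscriminant D D' mp mm) : IsDiscriminant (-D) (-D') mm mp where
  hasDerivAt x := (h.hasDerivAt x).neg
  deriv_ne_zero x hx := neg_ne_zero.2 (h.deriv_ne_zero x (by simpa using hx))
  mp_eq_zero x hx := h.mm_eq_zero x fun hD => hx (by simp [hD])
  mm_eq_zero x hx := h.mp_eq_zero x fun hD => hx (by simp [hD])
  mp_cases x hx := by simpa using h.mm_cases x (neg_eq_iff_eq_neg.1 hx)
  mm_cases x hx := by simpa using h.mp_cases x (neg_injective hx)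

theorem continuousAt (h : IsDiscriminant D D' mp mm) (x : ℝ) : ContinuousAt D x :=
  (h.hasDerivAt x).continuousAt

theorem eventually_mp_eq_zero (h : IsDiscriminant D D' mp mm) (x : ℝ) :
    ∀ᶠ y in 𝓝[≠] x, mp y = 0 := by
  suffices hne : ∀ᶠ y in 𝓝[≠] x, D y ≠ 2 from hne.mono h.mp_eq_zero
  by_cases hD : D x = 2
  · rcases h.mp_cases x hD with ⟨-, hsimple⟩ | ⟨-, hdouble⟩
    · exact (h.hasDerivAt x).eventually_ne hsimple
    · exact hdouble.mono fun y hy hD => by norm_num [hD] at hy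
  · exact ((h.continuousAt x).eventually_ne hD).filter_mono inf_le_left

theorem bandIndex_nhdsLT (h : IsDiscriminant D D' mp mm) {x : ℝ} (hD : D x = 2)
    (hlt : ∀ᶠ y in 𝓝[<] x, D y ^ 2 < 4) : ∀ᶠ y in 𝓝[<] x, bandIndex D D' y = -1 := by
  obtain ⟨a, ha, hax⟩ := mem_nhdsLT_iff_exists_Ioo_subset.1 hlt
  filter_upwards [Ioo_mem_nhdsLT ha] with y hy
  have hpos : 0 < D' y := deriv_pos_of_lt_right (fun z _ => h.hasDerivAt z)
    (fun z hz => h.deriv_ne_zero z (hax hz))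
    (fun z hz => hD ▸ (abs_lt_of_sq_lt_sq' ((hax hz).trans_eq (by norm_num)) zero_le_two).2) hy
  rw [bandIndex_of_sq_lt (hax hy), sign_pos hpos, SignType.coe_one]

theorem bandIndex_nhdsGT (h : IsDiscriminant D D' mp mm) {x : ℝ} (hD : D x = 2)
    (hlt : ∀ᶠ y in 𝓝[>] x, D y ^ 2 < 4) : ∀ᶠ y in 𝓝[>] x, bandIndex D D' y = 1 := by
  obtain ⟨b, hb, hxb⟩ := mem_nhdsGT_iff_exists_Ioo_subset.1 hlt
  filter_upwards [Ioo_mem_nhdsGT hb] with y hy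
  have hneg : D' y < 0 := deriv_neg_of_lt_left (fun z _ => h.hasDerivAt z)
    (fun z hz => h.deriv_ne_zero z (hxb hz))
    (fun z hz => hD ▸ (abs_lt_of_sq_lt_sq' ((hxb hz).trans_eq (by norm_num)) zero_le_two).2) hy
  rw [bandIndex_of_sq_lt (hxb hy), sign_neg hneg, SignType.coe_neg_one, neg_neg]

theorem bandIndex_jump_of_deriv_pos (h : IsDiscriminant D D' mp mm) {x : ℝ} (hD : D x = 2)
    (hpos : 0 < D' x) : (∀ᶠ y in 𝓝[<] x, bandIndex D D' y = -1) ∧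
      ∀ᶠ y in 𝓝[>] x, bandIndex D D' y = 0 := by
  have hslope : ∀ᶠ y in 𝓝[≠] x, 0 < slope D x y :=
    (hasDerivAt_iff_tendsto_slope.1 (h.hasDerivAt x)).eventually_const_lt hpos
  constructor
  · refine h.bandIndex_nhdsLT hD ?_
    filter_upwards [hslope.filter_mono (nhdsLT_le_nhdsNE x), self_mem_nhdsWithin,
      ((h.continuousAt x).eventually_const_lt (hD.symm ▸ by norm_num : -2 < D x)).filter_mono
        nhdsWithin_le_nhds] with y hy (hyx : y < x) hDy
    nlinarith [(slope_pos_iff_gt hyx).1 hy]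
  · filter_upwards [hslope.filter_mono (nhdsGT_le_nhdsNE x), self_mem_nhdsWithin] with y hy hxy
    exact bandIndex_of_le_sq (by nlinarith [(slope_pos_iff hxy).1 hy])

theorem bandIndex_jump_of_deriv_neg (h : IsDiscriminant D D' mp mm) {x : ℝ} (hD : D x = 2)
    (hneg : D' x < 0) : (∀ᶠ y in 𝓝[<] x, bandIndex D D' y = 0) ∧
      ∀ᶠ y in 𝓝[>] x, bandIndex D D' y = 1 := by
  have hslope : ∀ᶠ y in 𝓝[≠] x, 0 < slope (-D) x y :=
    (hasDerivAt_iff_tendsto_slope.1 (h.hasDerivAt x).neg).eventually_const_lt (neg_pos.2 hneg)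
  constructor
  · filter_upwards [hslope.filter_mono (nhdsLT_le_nhdsNE x), self_mem_nhdsWithin] with y hy hyx
    have hlt : D x < D y := neg_lt_neg_iff.1 ((slope_pos_iff_gt (f := -D) hyx).1 hy)
    exact bandIndex_of_le_sq (by nlinarith)
  · refine h.bandIndex_nhdsGT hD ?_
    filter_upwards [hslope.filter_mono (nhdsGT_le_nhdsNE x), self_mem_nhdsWithin,
      ((h.continuousAt x).eventually_const_lt (hD.symm ▸ by norm_num : -2 < D x)).filter_mono
        nhdsWithin_le_nhds] with y hy (hxy : x < y) hDy
    nlinarith [neg_lt_neg_iff.1 ((slope_pos_iff (f := -D) hxy).1 hy)]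

theorem exists_bandIndex_jump_eq_mp (h : IsDiscriminant D D' mp mm) {x : ℝ} (hD : D x = 2) :
    ∃ l r : ℤ, (∀ᶠ y in 𝓝[<] x, bandIndex D D' y = l) ∧ (∀ᶠ y in 𝓝[>] x, bandIndex D D' y = r) ∧
      r - l = mp x := by
  rcases h.mp_cases x hD with ⟨hm, hsimple⟩ | ⟨hm, hdouble⟩
  · rcases hsimple.lt_or_gt with hneg | hpos
    · exact ⟨0, 1, (h.bandIndex_jump_of_deriv_neg hD hneg).1,
        (h.bandIndex_jump_of_deriv_neg hD hneg).2, by simp [hm]⟩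
    · exact ⟨-1, 0, (h.bandIndex_jump_of_deriv_pos hD hpos).1,
        (h.bandIndex_jump_of_deriv_pos hD hpos).2, by simp [hm]⟩
  · exact ⟨-1, 1, h.bandIndex_nhdsLT hD (hdouble.filter_mono (nhdsLT_le_nhdsNE x)),
      h.bandIndex_nhdsGT hD (hdouble.filter_mono (nhdsGT_le_nhdsNE x)), by simp [hm]⟩

theorem eventually_bandIndex_eq (h : IsDiscriminant D D' mp mm) {x : ℝ} (hD : D x ^ 2 ≠ 4) :
    ∀ᶠ y in 𝓝 x, bandIndex D D' y = bandIndex D D' x := by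
  have hcont : ContinuousAt (fun y => D y ^ 2) x := (h.continuousAt x).pow 2
  rcases hD.lt_or_gt with hlt | hgt
  · obtain ⟨a, b, hx, hab⟩ := mem_nhds_iff_exists_Ioo_subset.1 (hcont.eventually_lt_const hlt)
    filter_upwards [Ioo_mem_nhds hx.1 hx.2] with y hy
    rw [bandIndex_of_sq_lt (hab hy), bandIndex_of_sq_lt hlt]
    rcases hasDerivWithinAt_forall_lt_or_forall_gt_of_forall_ne (convex_Ioo a b)
      (fun z _ => (h.hasDerivAt z).hasDerivWithinAt) (fun z hz => h.deriv_ne_zero z (hab hz))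
      with hneg | hpos
    · rw [sign_neg (hneg y hy), sign_neg (hneg x hx)]
    · rw [sign_pos (hpos y hy), sign_pos (hpos x hx)]
  · filter_upwards [hcont.eventually_const_lt hgt] with y hy
    rw [bandIndex_of_le_sq hy.le, bandIndex_of_le_sq hgt.le]

theorem exists_bandIndex_jump_eq (h : IsDiscriminant D D' mp mm) (x : ℝ) :
    ∃ l r : ℤ, (∀ᶠ y in 𝓝[<] x, bandIndex D D' y = l) ∧ (∀ᶠ y in 𝓝[>] x, bandIndex D D' y = r) ∧
      r - l = mp x - mm x := by
  by_cases hpos : D x = 2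
  · obtain ⟨l, r, hl, hr, hlr⟩ := h.exists_bandIndex_jump_eq_mp hpos
    exact ⟨l, r, hl, hr, by rw [hlr, h.mm_eq_zero x (by norm_num [hpos]), Nat.cast_zero, sub_zero]⟩
  by_cases hneg : D x = -2
  · obtain ⟨l, r, hl, hr, hlr⟩ := h.neg.exists_bandIndex_jump_eq_mp (x := x) (by simp [hneg])
    refine ⟨-l, -r, hl.mono fun y hy => ?_, hr.mono fun y hy => ?_, ?_⟩
    · rw [← hy, bandIndex_neg, neg_neg]
    · rw [← hy, bandIndex_neg, neg_neg]
    · rw [h.mp_eq_zero x hpos, ← hlr]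
      ring
  · have hD : D x ^ 2 ≠ 4 := fun hD => by
      rcases sq_eq_sq_iff_eq_or_eq_neg.1 (hD.trans (by norm_num : (4 : ℝ) = 2 ^ 2)) with h2 | h2
      exacts [hpos h2, hneg h2]
    have hG := h.eventually_bandIndex_eq hD
    exact ⟨_, _, hG.filter_mono nhdsWithin_le_nhds, hG.filter_mono nhdsWithin_le_nhds,
      by rw [h.mp_eq_zero x hpos, h.mm_eq_zero x hneg]; ring⟩

variable {ι κ : Type*} {per : ι → ℝ} {semi : κ → ℝ}

theorem eventually_count_sub_count_eq_bandIndex (h : IsDiscriminant D D' mp mm)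
    (hper : ∀ μ, {i | per i = μ}.encard = mp μ) (hsemi : ∀ μ, {i | semi i = μ}.encard = mm μ)
    {x₀ : ℝ} (hx₀ : ∀ x ≤ x₀, 2 < D x) (x : ℝ) : (∀ᶠ y in 𝓝[≠] x,
      ({i | per i < y}.ncard : ℤ) - {i | semi i < y}.ncard = bandIndex D D' y) := by
  have hmp₀ : ∀ x ≤ x₀, mp x = 0 := fun x hx => h.mp_eq_zero x (hx₀ x hx).ne'
  have hmm₀ : ∀ x ≤ x₀, mm x = 0 := fun x hx => h.mm_eq_zero x (by linarith [hx₀ x hx])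
  have hmp (x : ℝ) := h.eventually_mp_eq_zero x
  have hmm (x : ℝ) := h.neg.eventually_mp_eq_zero x
  have hper_ne (x : ℝ) := (hmp x).mono fun w hw => ne_of_multiplicity_eq_zero hper hw
  have hsemi_ne (x : ℝ) := (hmm x).mono fun w hw => ne_of_multiplicity_eq_zero hsemi hw
  -- Across each point, the difference of the counts and the index jump by the same amount.
  have hlocal (x : ℝ) : ∃ c : ℤ, ∀ᶠ y in 𝓝[≠] x,
      ({i | per i < y}.ncard : ℤ) - {i | semi i < y}.ncard - bandIndex D D' y = c := by
    obtain ⟨l, r, hl, hr, hlr⟩ := h.exists_bandIndex_jump_eq x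
    refine ⟨{i | per i < x}.ncard - {i | semi i < x}.ncard - l, ?_⟩
    rw [← nhdsLT_sup_nhdsGT]
    refine eventually_sup.2 ⟨?_, ?_⟩
    · filter_upwards [eventually_nhdsLT_setOf_lt_eq (hper_ne x),
        eventually_nhdsLT_setOf_lt_eq (hsemi_ne x), hl] with y hpery hsemiy hy
      rw [hpery, hsemiy, hy]
    · filter_upwards [eventually_nhdsGT_setOf_lt_eq (hper_ne x),
        eventually_nhdsGT_setOf_lt_eq (hsemi_ne x), hr] with y hpery hsemiy hy
      rw [hpery, hsemiy, hy, ncard_setOf_le hper (finite_setOf_lt hper hmp hmp₀ x),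
        ncard_setOf_le hsemi (finite_setOf_lt hsemi hmm hmm₀ x)]
      push_cast
      linarith
  have hleft : ∀ᶠ y in 𝓝[≠] (x₀ - 1),
      ({i | per i < y}.ncard : ℤ) - {i | semi i < y}.ncard - bandIndex D D' y = 0 := by
    filter_upwards [nhdsWithin_le_nhds (Iio_mem_nhds (sub_one_lt x₀))] with y hy
    rw [setOf_lt_eq_empty hper hmp₀ (le_of_lt hy), setOf_lt_eq_empty hsemi hmm₀ (le_of_lt hy),
      bandIndex_of_le_sq (by nlinarith [hx₀ y (le_of_lt hy)]), Set.ncard_empty, Set.ncard_empty]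
    simp
  exact (eventually_nhdsNE_eq_of_locally_const hlocal hleft x).mono fun y hy => sub_eq_zero.1 hy

theorem sq_lt_four_of_bandIndex_pos (h : IsDiscriminant D D' mp mm) {x : ℝ}
    (hx : ∀ᶠ y in 𝓝[≠] x, 0 < bandIndex D D' y) : D x ^ 2 < 4 := by
  have hband : ∀ᶠ y in 𝓝[≠] x, D y ^ 2 < 4 := hx.mono fun y hy => by
    by_contra! hge
    exact hy.ne' (bandIndex_of_le_sq hge)
  have hleft := hband.filter_mono (nhdsLT_le_nhdsNE x)
  have hright := hband.filter_mono (nhdsGT_le_nhdsNE x)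
  refine lt_of_le_of_ne (le_of_tendsto (((h.continuousAt x).pow 2).tendsto.mono_left
    nhdsWithin_le_nhds) (hband.mono fun _ hy => hy.le)) fun hD => ?_
  rcases sq_eq_sq_iff_eq_or_eq_neg.1 (hD.trans (by norm_num : (4 : ℝ) = 2 ^ 2)) with hD | hD
  · obtain ⟨y, hy, hypos⟩ :=
      ((h.bandIndex_nhdsLT hD hleft).and (hx.filter_mono (nhdsLT_le_nhdsNE x))).exists
    lia
  · obtain ⟨y, hy, hypos⟩ := ((h.neg.bandIndex_nhdsGT (x := x) (by simp [hD])
      (by simpa using hright)).and (hx.filter_mono (nhdsGT_le_nhdsNE x))).exists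
    rw [bandIndex_neg] at hy
    lia

theorem sq_lt_four_of_count_lt (h : IsDiscriminant D D' mp mm)
    (hper : ∀ μ, {i | per i = μ}.encard = mp μ) (hsemi : ∀ μ, {i | semi i = μ}.encard = mm μ)
    {x₀ : ℝ} (hx₀ : ∀ x ≤ x₀, 2 < D x) {x : ℝ}
    (hx : ∀ᶠ y in 𝓝 x, {i | semi i < y}.ncard < {i | per i < y}.ncard) : D x ^ 2 < 4 := by
  refine h.sq_lt_four_of_bandIndex_pos ?_
  filter_upwards [h.eventually_count_sub_count_eq_bandIndex hper hsemi hx₀ x,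
    hx.filter_mono nhdsWithin_le_nhds] with y hy hlt
  lia

theorem sq_lt_four_of_lt_count (h : IsDiscriminant D D' mp mm)
    (hper : ∀ μ, {i | per i = μ}.encard = mp μ) (hsemi : ∀ μ, {i | semi i = μ}.encard = mm μ)
    {x₀ : ℝ} (hx₀ : ∀ x ≤ x₀, 2 < D x) {x : ℝ}
    (hx : ∀ᶠ y in 𝓝 x, {i | per i < y}.ncard < {i | semi i < y}.ncard) : D x ^ 2 < 4 := by
  have hneg := h.neg.sq_lt_four_of_bandIndex_pos (x := x) (by
    filter_upwards [h.eventually_count_sub_count_eq_bandIndex hper hsemi hx₀ x,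
      hx.filter_mono nhdsWithin_le_nhds] with y hy hlt
    rw [bandIndex_neg]
    lia)
  simpa using hneg

theorem sq_lt_four_of_mem {per semi : ℕ → ℝ} (h : IsDiscriminant D D' mp mm)
    (hper_mono : Monotone per) (hper : ∀ μ, {i | per i = μ}.encard = mp μ)
    (hsemi_mono : Monotone semi) (hsemi : ∀ μ, {i | semi i = μ}.encard = mm μ)
    {x₀ : ℝ} (hx₀ : ∀ x ≤ x₀, 2 < D x) {n : ℕ} {x : ℝ}
    (hx : x ∈ Set.Ioo (per n) (semi n) ∨ x ∈ Set.Ioo (semi n) (per n)) : D x ^ 2 < 4 := by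
  rcases hx with hx | hx
  · refine h.sq_lt_four_of_count_lt hper hsemi hx₀ ?_
    filter_upwards [Ioo_mem_nhds hx.1 hx.2] with y hy
    exact ncard_lt_ncard_of_mem_Ioo hper_mono hsemi_mono (finite_setOf_lt hper
      h.eventually_mp_eq_zero (fun x hx => h.mp_eq_zero x (hx₀ x hx).ne') y) hy
  · refine h.sq_lt_four_of_lt_count hper hsemi hx₀ ?_
    filter_upwards [Ioo_mem_nhds hx.1 hx.2] with y hy
    exact ncard_lt_ncard_of_mem_Ioo hsemi_mono hper_mono (finite_setOf_lt hsemi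
      h.neg.eventually_mp_eq_zero (fun x hx => h.mm_eq_zero x (by linarith [hx₀ x hx])) y) hy

end IsDiscriminant

/-! ### The monodromy matrix and the discriminant -/

section TwoByTwo

variable {K : Type*} [Field K] (M : Matrix (Fin 2) (Fin 2) K) {s : K}

theorem finrank_eigenspace_toLin'_eq_zero (h : ¬M.charpoly.IsRoot s) :
    Module.finrank K (Module.End.eigenspace (Matrix.toLin' M) s) = 0 := by
  rw [← Matrix.charpoly_toLin', ← Module.End.hasEigenvalue_iff_isRoot_charpoly,
    Module.End.hasEigenvalue_iff, not_not] at h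
  rw [h, finrank_bot]

theorem eigenspace_toLin'_eq_top_iff :
    Module.End.eigenspace (Matrix.toLin' M) s = ⊤ ↔ M = s • (1 : Matrix (Fin 2) (Fin 2) K) := by
  rw [Module.End.eigenspace_def, LinearMap.ker_eq_top, sub_eq_zero,
    ← Matrix.toLin'.injective.eq_iff (a := M)]
  simp [Module.End.one_eq_id]

theorem finrank_eigenspace_toLin'_eq_two (h : M = s • (1 : Matrix (Fin 2) (Fin 2) K)) :
    Module.finrank K (Module.End.eigenspace (Matrix.toLin' M) s) = 2 := by
  rw [(eigenspace_toLin'_eq_top_iff M).2 h, finrank_top, Module.finrank_fin_fun]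

theorem finrank_eigenspace_toLin'_eq_one (h : M.charpoly.IsRoot s)
    (hM : M ≠ s • (1 : Matrix (Fin 2) (Fin 2) K)) :
    Module.finrank K (Module.End.eigenspace (Matrix.toLin' M) s) = 1 := by
  rw [← Matrix.charpoly_toLin', ← Module.End.hasEigenvalue_iff_isRoot_charpoly,
    Module.End.hasEigenvalue_iff] at h
  have hpos := Submodule.one_le_finrank_iff.2 h
  have hlt := Submodule.finrank_lt ((eigenspace_toLin'_eq_top_iff M).not.2 hM)
  rw [Module.finrank_fin_fun] at hlt
  lia

end TwoByTwo

theorem eq_zero_of_posDef_of_discr_nonpos {A B C p r s : ℝ}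
    (hpos : ∀ a b : ℝ, ¬(a = 0 ∧ b = 0) → 0 < a ^ 2 * A + 2 * a * b * B + b ^ 2 * C)
    (h : p * A + r * B + s * C = 0) (hr : r ^ 2 ≤ 4 * (p * s)) : p = 0 ∧ r = 0 ∧ s = 0 := by
  have hC : 0 < C := by simpa using hpos 0 1
  have hp : p = 0 := by
    by_contra hp
    have hquad := hpos p (r / 2) fun h0 => hp h0.1
    have hrC : r ^ 2 * C ≤ 4 * (p * s) * C := mul_le_mul_of_nonneg_right hr hC.le
    have hzero : p ^ 2 * A + p * r * B + p * s * C = 0 := by linear_combination p * h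
    nlinarith
  have hr0 : r = 0 := by
    rw [hp, zero_mul, mul_zero] at hr
    exact pow_eq_zero_iff two_ne_zero |>.1 (le_antisymm hr (sq_nonneg r))
  rw [hp, hr0, zero_mul, zero_mul, zero_add, zero_add] at h
  exact ⟨hp, hr0, (mul_eq_zero.1 h).resolve_right hC.ne'⟩

namespace FundamentalSystem

section General

variable {𝕜 : Type*} [RCLike 𝕜] {q : ℝ → ℝ} (S : FundamentalSystem 𝕜 q) {ℓ : ℝ}

/-- The monodromy matrix over `[0, ℓ]`, which maps the data `(y, y')` at `0` to those at `ℓ`. -/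
def monodromy (ℓ : ℝ) (z : 𝕜) : Matrix (Fin 2) (Fin 2) 𝕜 :=
  !![S.u z ℓ, S.v z ℓ; S.du z ℓ, S.dv z ℓ]

/-- Hill's discriminant, the trace of the monodromy matrix. -/
def disc (ℓ : ℝ) (z : 𝕜) : 𝕜 := S.u z ℓ + S.dv z ℓ

/-- The matrix `N` of the identity `M(z)⁻¹ M(w) = 1 + (w - z) N` between monodromy matrices, which
is Lagrange's identity for the pairs of fundamental solutions. -/
noncomputable def lagrangeMatrix (ℓ : ℝ) (z w : 𝕜) : Matrix (Fin 2) (Fin 2) 𝕜 :=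
  !![∫ t in (0 : ℝ)..ℓ, S.u w t * S.v z t, ∫ t in (0 : ℝ)..ℓ, S.v w t * S.v z t;
    -∫ t in (0 : ℝ)..ℓ, S.u w t * S.u z t, -∫ t in (0 : ℝ)..ℓ, S.v w t * S.u z t]

theorem monodromy_mulVec {z : 𝕜} {y dy : ℝ → 𝕜} (h : IsHillSolution q z y dy) (hℓ : 0 ≤ ℓ) :
    (S.monodromy ℓ z).mulVec ![y 0, dy 0] = ![y ℓ, dy ℓ] := by
  rw [(S.eq_comb h hℓ).1, (S.eq_comb h hℓ).2, monodromy, Matrix.cons_mulVec, Matrix.cons_mulVec]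
  simp [mul_comm]

theorem trace_monodromy (z : 𝕜) : (S.monodromy ℓ z).trace = S.disc ℓ z :=
  Matrix.trace_fin_two_of _ _ _ _

theorem det_monodromy (hℓ : 0 ≤ ℓ) (z : 𝕜) : (S.monodromy ℓ z).det = 1 := by
  rw [monodromy, Matrix.det_fin_two_of]
  exact S.wronskian z hℓ

theorem discr_monodromy (hℓ : 0 ≤ ℓ) (z : 𝕜) :
    (S.monodromy ℓ z).discr = S.disc ℓ z ^ 2 - 4 := by
  rw [Matrix.discr_fin_two, S.trace_monodromy, S.det_monodromy hℓ, mul_one]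

theorem disc_sq_sub_four (hℓ : 0 ≤ ℓ) (z : 𝕜) :
    S.disc ℓ z ^ 2 - 4 = (S.dv z ℓ - S.u z ℓ) ^ 2 + 4 * (S.v z ℓ * S.du z ℓ) := by
  rw [disc]
  linear_combination 4 * S.wronskian z hℓ

theorem continuous_disc (ℓ : ℝ) : Continuous (S.disc ℓ) :=
  (S.continuous_u.uncurry_right ℓ).add (S.continuous_dv.uncurry_right ℓ)

theorem continuous_lagrangeMatrix (ℓ : ℝ) (z : 𝕜) : Continuous (S.lagrangeMatrix ℓ z) := by
  have hcont {f : 𝕜 → ℝ → 𝕜} {g : ℝ → 𝕜} (hf : Continuous (Function.uncurry f))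
      (hg : Continuous g) :
      Continuous fun w => ∫ t in (0 : ℝ)..ℓ, f w t * g t :=
    intervalIntegral.continuous_parametric_intervalIntegral_of_continuous'
      (hf.mul (hg.comp continuous_snd)) 0 ℓ
  have hu := S.continuous_u.uncurry_left z
  have hv := S.continuous_v.uncurry_left z
  refine continuous_matrix fun i j => ?_
  fin_cases i <;> fin_cases j
  exacts [hcont S.continuous_u hv, hcont S.continuous_v hv, (hcont S.continuous_u hu).neg,
    (hcont S.continuous_v hu).neg]

theorem monodromy_eq (hℓ : 0 ≤ ℓ) (z w : 𝕜) :
    S.monodromy ℓ w = S.monodromy ℓ z * (1 + (w - z) • S.lagrangeMatrix ℓ z w) := by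
  have hq := S.locallyIntegrable
  have huv := ((S.solution_u w).isPrimitive_wronskian hq (S.solution_v z)).eq ℓ hℓ
  have hvv := ((S.solution_v w).isPrimitive_wronskian hq (S.solution_v z)).eq ℓ hℓ
  have huu := ((S.solution_u w).isPrimitive_wronskian hq (S.solution_u z)).eq ℓ hℓ
  have hvu := ((S.solution_v w).isPrimitive_wronskian hq (S.solution_u z)).eq ℓ hℓ
  have hw := S.wronskian z hℓ
  simp only [intervalIntegral.integral_const_mul, S.u_zero, S.du_zero, S.v_zero, S.dv_zero]
    at huv hvv huu hvu
  ext i j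
  fin_cases i <;> fin_cases j <;>
    simp only [monodromy, lagrangeMatrix, Fin.zero_eta, Fin.mk_one, Matrix.mul_apply,
      Fin.sum_univ_two, Matrix.add_apply, Matrix.smul_apply, Matrix.one_apply, smul_eq_mul,
      Matrix.of_apply, Matrix.cons_val_zero, Matrix.cons_val_one, Matrix.cons_val', if_true,
      Matrix.cons_val_fin_one, one_ne_zero, zero_ne_one, if_false]
  · linear_combination S.u z ℓ * huv - S.v z ℓ * huu - S.u w ℓ * hw
  · linear_combination S.u z ℓ * hvv - S.v z ℓ * hvu - S.v w ℓ * hw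
  · linear_combination S.du z ℓ * huv - S.dv z ℓ * huu - S.du w ℓ * hw
  · linear_combination S.du z ℓ * hvv - S.dv z ℓ * hvu - S.dv w ℓ * hw

theorem hasDerivAt_disc (hℓ : 0 ≤ ℓ) (z : 𝕜) :
    HasDerivAt (S.disc ℓ) (S.monodromy ℓ z * S.lagrangeMatrix ℓ z z).trace z := by
  rw [hasDerivAt_iff_tendsto_slope]
  have hcont : Continuous fun w => (S.monodromy ℓ z * S.lagrangeMatrix ℓ z w).trace :=
    (continuous_const.matrix_mul (S.continuous_lagrangeMatrix ℓ z)).matrix_trace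
  refine ((hcont.tendsto z).mono_left nhdsWithin_le_nhds).congr' ?_
  filter_upwards [self_mem_nhdsWithin] with w (hw : w ≠ z)
  rw [slope_def_field, ← S.trace_monodromy w, S.monodromy_eq hℓ z w, mul_add, mul_one,
    Matrix.trace_add, S.trace_monodromy, add_sub_cancel_left, Matrix.mul_smul, Matrix.trace_smul,
    smul_eq_mul, mul_div_cancel_left₀ _ (sub_ne_zero.2 hw)]

end General

variable {q : ℝ → ℝ} (S : FundamentalSystem ℝ q) {ℓ x s : ℝ}

theorem v_ne_zero (hℓ : 0 ≤ ℓ) (hD : S.disc ℓ x ^ 2 < 4) : S.v x ℓ ≠ 0 := fun h0 => by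
  have hdiscr := S.disc_sq_sub_four hℓ x
  rw [h0, zero_mul, mul_zero, add_zero] at hdiscr
  linarith [sq_nonneg (S.dv x ℓ - S.u x ℓ)]

theorem gram_pos (hℓ : 0 < ℓ) (x : ℝ) {a b : ℝ} (hab : ¬(a = 0 ∧ b = 0)) :
    0 < a ^ 2 * (∫ t in (0 : ℝ)..ℓ, S.u x t * S.u x t)
      + 2 * a * b * (∫ t in (0 : ℝ)..ℓ, S.u x t * S.v x t)
      + b ^ 2 * ∫ t in (0 : ℝ)..ℓ, S.v x t * S.v x t := by
  have hpos := ((S.solution_u x).linear_comb S.locallyIntegrable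
    (S.solution_v x) a b).integral_norm_sq_pos hℓ
      (by simpa [S.u_zero, S.du_zero, S.v_zero, S.dv_zero] using hab)
  have hu := S.continuous_u.uncurry_left x
  have hv := S.continuous_v.uncurry_left x
  rw [← intervalIntegral.integral_const_mul, ← intervalIntegral.integral_const_mul,
    ← intervalIntegral.integral_const_mul, ← intervalIntegral.integral_add,
    ← intervalIntegral.integral_add]
  · refine hpos.trans_eq (intervalIntegral.integral_congr fun t _ => ?_)
    simp only [Real.norm_eq_abs, sq_abs]
    ring
  all_goals exact Continuous.intervalIntegrable (by fun_prop) _ _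

theorem integral_v_mul_u (ℓ x : ℝ) :
    (∫ t in (0 : ℝ)..ℓ, S.v x t * S.u x t) = ∫ t in (0 : ℝ)..ℓ, S.u x t * S.v x t := by
  simp only [mul_comm]

theorem discr_lagrangeMatrix_neg (hℓ : 0 < ℓ) (x : ℝ) : (S.lagrangeMatrix ℓ x x).discr < 0 := by
  have hC : 0 < ∫ t in (0 : ℝ)..ℓ, S.v x t * S.v x t := by
    simpa using S.gram_pos hℓ x (a := 0) (b := 1) (by simp)
  have hquad := S.gram_pos hℓ x (a := ∫ t in (0 : ℝ)..ℓ, S.v x t * S.v x t)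
    (b := -∫ t in (0 : ℝ)..ℓ, S.u x t * S.v x t) fun h0 => hC.ne' h0.1
  rw [Matrix.discr_fin_two, lagrangeMatrix, Matrix.trace_fin_two_of, Matrix.det_fin_two_of,
    integral_v_mul_u]
  nlinarith

theorem monodromy_eq_smul_one (hℓ : 0 < ℓ)
    (hcrit : (S.monodromy ℓ x * S.lagrangeMatrix ℓ x x).trace = 0) (hD : S.disc ℓ x ^ 2 ≤ 4) :
    S.monodromy ℓ x = S.u x ℓ • (1 : Matrix (Fin 2) (Fin 2) ℝ) := by
  have hdiscr := S.disc_sq_sub_four hℓ.le x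
  rw [monodromy, lagrangeMatrix, integral_v_mul_u, Matrix.trace_fin_two, Matrix.mul_apply,
    Matrix.mul_apply, Fin.sum_univ_two, Fin.sum_univ_two] at hcrit
  simp only [Matrix.of_apply, Matrix.cons_val_zero, Matrix.cons_val_one, Matrix.cons_val',
    Matrix.cons_val_fin_one] at hcrit
  obtain ⟨hv, hdiag, hdu⟩ := eq_zero_of_posDef_of_discr_nonpos (p := S.v x ℓ)
    (r := S.dv x ℓ - S.u x ℓ) (s := -S.du x ℓ) (fun a b hab => S.gram_pos hℓ x hab)
    (by linarith) (by linarith)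
  rw [monodromy, hv, neg_eq_zero.1 hdu, sub_eq_zero.1 hdiag, Matrix.smul_one_eq_diagonal]
  ext i j
  fin_cases i <;> fin_cases j <;> simp

theorem eventually_disc_sq_lt (hℓ : 0 < ℓ) (hs : s ≠ 0)
    (hM : S.monodromy ℓ x = s • (1 : Matrix (Fin 2) (Fin 2) ℝ)) :
    ∀ᶠ y in 𝓝[≠] x, S.disc ℓ y ^ 2 < 4 := by
  have hcont : Continuous fun y => (S.lagrangeMatrix ℓ x y).discr := by
    simp only [Matrix.discr_fin_two]
    exact ((S.continuous_lagrangeMatrix ℓ x).matrix_trace.pow 2).sub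
      (continuous_const.mul (S.continuous_lagrangeMatrix ℓ x).matrix_det)
  have hneg := hcont.continuousAt.eventually_lt_const (S.discr_lagrangeMatrix_neg hℓ x)
  filter_upwards [hneg.filter_mono nhdsWithin_le_nhds, self_mem_nhdsWithin] with y hy (hyx : y ≠ x)
  have hdisc : S.disc ℓ y ^ 2 - 4 = (s * (y - x)) ^ 2 * (S.lagrangeMatrix ℓ x y).discr := by
    rw [← S.discr_monodromy hℓ.le, S.monodromy_eq hℓ.le x y, hM, Matrix.smul_mul, one_mul]
    simp only [Matrix.discr_fin_two, Matrix.trace_fin_two, Matrix.det_fin_two, Matrix.add_apply,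
      Matrix.smul_apply, Matrix.one_apply, smul_eq_mul, if_true, Fin.reduceEq, if_false]
    ring
  have hsq : 0 < (s * (y - x)) ^ 2 := sq_pos_of_ne_zero (mul_ne_zero hs (sub_ne_zero.2 hyx))
  linarith [mul_neg_of_pos_of_neg hsq hy]

theorem eigenvalueMultiplicity_eq_finrank (hℓ : 0 ≤ ℓ) (hs : s * s = 1) (x : ℝ) :
    eigenvalueMultiplicity q ℓ s x =
      Module.finrank ℝ (Module.End.eigenspace (Matrix.toLin' (S.monodromy ℓ x)) s) := by
  have hflip {a b : ℝ} (h : a = s * b) : b = s * a := by rw [h, ← mul_assoc, hs, one_mul]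
  have hset : {d : ℝ × ℝ | ∃ y dy : ℝ → ℝ, IsHillSolution q x y dy ∧
      y 0 = d.1 ∧ dy 0 = d.2 ∧ y 0 = s * y ℓ ∧ dy 0 = s * dy ℓ} =
      (Module.End.eigenspace (Matrix.toLin' (S.monodromy ℓ x)) s).map
        (LinearEquiv.finTwoArrow ℝ ℝ).toLinearMap := by
    ext d
    rw [SetLike.mem_coe, Submodule.mem_map_equiv, Module.End.mem_eigenspace_iff,
      Matrix.toLin'_apply, show (LinearEquiv.finTwoArrow ℝ ℝ).symm d = ![d.1, d.2] from rfl]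
    constructor
    · rintro ⟨y, dy, h, h0, h1, hb0, hb1⟩
      rw [← h0, ← h1, S.monodromy_mulVec h hℓ, hflip hb0, hflip hb1, Matrix.smul_vec2, smul_eq_mul,
        smul_eq_mul]
    · intro h
      have hy := (S.solution_u x).linear_comb S.locallyIntegrable (S.solution_v x) d.1 d.2
      have h0 : d.1 * S.u x 0 + d.2 * S.v x 0 = d.1 := by simp [S.u_zero, S.v_zero]
      have h1 : d.1 * S.du x 0 + d.2 * S.dv x 0 = d.2 := by simp [S.du_zero, S.dv_zero]
      have hM := S.monodromy_mulVec hy hℓ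
      rw [h0, h1, h, Matrix.smul_vec2] at hM
      refine ⟨_, _, hy, h0, h1, ?_, ?_⟩
      · rw [h0]
        exact hflip (congrFun hM 0).symm
      · rw [h1]
        exact hflip (congrFun hM 1).symm
  rw [eigenvalueMultiplicity, hset, Set.finrank, Submodule.span_eq]
  exact LinearEquiv.finrank_map_eq _ _

theorem isRoot_charpoly_monodromy_iff (hℓ : 0 ≤ ℓ) (hs : s * s = 1) :
    (S.monodromy ℓ x).charpoly.IsRoot s ↔ S.disc ℓ x = 2 * s := by
  rw [Matrix.charpoly_fin_two, S.trace_monodromy, S.det_monodromy hℓ, Polynomial.IsRoot.def]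
  simp only [map_one, Polynomial.eval_add, Polynomial.eval_sub, Polynomial.eval_pow,
    Polynomial.eval_X, Polynomial.eval_mul, Polynomial.eval_C, Polynomial.eval_one]
  constructor <;> intro h
  · linear_combination (-s) * h + (s - S.disc ℓ x) * hs
  · rw [h]
    linear_combination -hs

theorem eigenvalueMultiplicity_eq_zero (hℓ : 0 ≤ ℓ) (hs : s * s = 1)
    (hD : S.disc ℓ x ≠ 2 * s) : eigenvalueMultiplicity q ℓ s x = 0 := by
  rw [S.eigenvalueMultiplicity_eq_finrank hℓ hs]
  exact finrank_eigenspace_toLin'_eq_zero _ ((S.isRoot_charpoly_monodromy_iff hℓ hs).not.2 hD)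

theorem eigenvalueMultiplicity_cases (hℓ : 0 < ℓ) (hs : s * s = 1) (hD : S.disc ℓ x = 2 * s) :
    eigenvalueMultiplicity q ℓ s x = 1 ∧
        (S.monodromy ℓ x * S.lagrangeMatrix ℓ x x).trace ≠ 0 ∨
      eigenvalueMultiplicity q ℓ s x = 2 ∧ ∀ᶠ y in 𝓝[≠] x, S.disc ℓ y ^ 2 < 4 := by
  rw [S.eigenvalueMultiplicity_eq_finrank hℓ.le hs]
  by_cases hM : S.monodromy ℓ x = s • (1 : Matrix (Fin 2) (Fin 2) ℝ)
  · have hs0 : s ≠ 0 := left_ne_zero_of_mul_eq_one hs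
    exact Or.inr ⟨finrank_eigenspace_toLin'_eq_two _ hM, S.eventually_disc_sq_lt hℓ hs0 hM⟩
  · refine Or.inl ⟨finrank_eigenspace_toLin'_eq_one _
      ((S.isRoot_charpoly_monodromy_iff hℓ.le hs).2 hD) hM, fun hcrit => hM ?_⟩
    have hscalar := S.monodromy_eq_smul_one hℓ hcrit (by rw [hD]; linarith)
    have htrace := S.trace_monodromy (ℓ := ℓ) x
    rw [hscalar, Matrix.trace_smul, Matrix.trace_one, hD] at htrace
    simp only [Fintype.card_fin, Nat.cast_ofNat, smul_eq_mul] at htrace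
    rw [hscalar, show S.u x ℓ = s by linarith]

theorem isDiscriminant_disc (hℓ : 0 < ℓ) :
    IsDiscriminant (S.disc ℓ) (fun x => (S.monodromy ℓ x * S.lagrangeMatrix ℓ x x).trace)
      (eigenvalueMultiplicity q ℓ 1) (eigenvalueMultiplicity q ℓ (-1)) where
  hasDerivAt x := S.hasDerivAt_disc hℓ.le x
  deriv_ne_zero x hx hcrit := by
    have hdiscr := S.discr_monodromy hℓ.le x
    rw [S.monodromy_eq_smul_one hℓ hcrit hx.le, Matrix.discr_fin_two] at hdiscr
    simp [Matrix.trace_smul] at hdiscr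
    nlinarith
  mp_eq_zero x hx := S.eigenvalueMultiplicity_eq_zero hℓ.le (by norm_num) (by simpa using hx)
  mm_eq_zero x hx := S.eigenvalueMultiplicity_eq_zero hℓ.le (by norm_num) (by simpa using hx)
  mp_cases x hx := S.eigenvalueMultiplicity_cases hℓ (by norm_num) (by simpa using hx)
  mm_cases x hx := S.eigenvalueMultiplicity_cases hℓ (by norm_num) (by simpa using hx)

end FundamentalSystem

/-! ### The discriminant far to the left -/

namespace IsPrimitive

variable {F f : ℝ → ℝ} {α β W Y : ℝ → ℝ} {ℓ : ℝ}

theorem of_hasDerivAt (hF : ∀ x, HasDerivAt F (f x) x) (hf : Continuous f) : IsPrimitive F f :=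
  .of_continuousOn hf.continuousOn fun x _ => by
    rw [intervalIntegral.integral_eq_sub_of_hasDerivAt (fun t _ => hF t)
      (hf.intervalIntegrable 0 x), add_sub_cancel]

theorem le_of_density_nonneg (hF : IsPrimitive F f) {x : ℝ} (hx : 0 ≤ x)
    (hf : ∀ t ∈ Set.Icc 0 x, 0 ≤ f t) : F 0 ≤ F x := by
  rw [hF.eq x hx]
  exact le_add_of_nonneg_right (intervalIntegral.integral_nonneg hx hf)

theorem le_of_cooperative (hY : IsPrimitive Y fun t => α t * W t)
    (hW : IsPrimitive W fun t => β t * Y t) (hα : ∀ t ∈ Set.Icc 0 ℓ, 0 ≤ α t)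
    (hβ : ∀ t ∈ Set.Icc 0 ℓ, 0 ≤ β t) (hY0 : 0 < Y 0) (hW0 : 0 ≤ W 0) (hℓ : 0 ≤ ℓ) :
    Y 0 ≤ Y ℓ := by
  have hYW : ∀ x ∈ Set.Icc 0 ℓ, 0 ≤ Y x * W x := fun x hx =>
    (mul_nonneg hY0.le hW0).trans <| (hY.mul hW).le_of_density_nonneg hx.1 fun t ht => by
      have htℓ : t ∈ Set.Icc 0 ℓ := ⟨ht.1, ht.2.trans hx.2⟩
      have hsum := add_nonneg (mul_nonneg (hα t htℓ) (sq_nonneg (W t)))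
        (mul_nonneg (hβ t htℓ) (sq_nonneg (Y t)))
      linarith
  have hsq : ∀ x ∈ Set.Icc 0 ℓ, Y 0 * Y 0 ≤ Y x * Y x := fun x hx =>
    (hY.mul hY).le_of_density_nonneg hx.1 fun t ht => by
      have htℓ : t ∈ Set.Icc 0 ℓ := ⟨ht.1, ht.2.trans hx.2⟩
      have hprod := mul_nonneg (hα t htℓ) (hYW t htℓ)
      linarith
  have hpos : 0 < Y ℓ := by
    by_contra! hneg
    obtain ⟨x, hx, hYx⟩ := intermediate_value_Icc' hℓ
      (hY.continuousOn.mono Set.Icc_subset_Ici_self) ⟨hneg, hY0.le⟩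
    have hle := hsq x hx
    rw [hYx, mul_zero] at hle
    exact (mul_pos hY0 hY0).not_ge hle
  exact (mul_self_le_mul_self_iff hY0.le hpos.le).2 (hsq ℓ ⟨hℓ, le_rfl⟩)

end IsPrimitive

/-- The first order system for `Y = exp (-G) y` and `W = exp G (y' - g y)`, where `G' = g` and
`g' = q - c`. For `g ^ 2 ≤ c - z` it is cooperative, i.e. both coefficients are nonnegative. -/
theorem IsHillSolution.isPrimitive_exp_mul {q g G y dy : ℝ → ℝ} {c z : ℝ}
    (hq : LocallyIntegrable q volume) (h : IsHillSolution q z y dy)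
    (hg : IsPrimitive g fun t => q t - c) (hgc : Continuous g) (hG : ∀ x, HasDerivAt G (g x) x) :
    IsPrimitive (fun x => Real.exp (-G x) * y x)
        (fun x => Real.exp (-2 * G x) * (Real.exp (G x) * (dy x - g x * y x))) ∧
      IsPrimitive (fun x => Real.exp (G x) * (dy x - g x * y x))
        (fun x => Real.exp (2 * G x) * (c - z - g x ^ 2) * (Real.exp (-G x) * y x)) := by
  have hGc : Continuous G := continuous_iff_continuousAt.2 fun x => (hG x).continuousAt
  have hexp : IsPrimitive (fun x => Real.exp (G x)) fun x => Real.exp (G x) * g x :=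
    .of_hasDerivAt (fun x => (hG x).exp) (by fun_prop)
  have hexp_neg : IsPrimitive (fun x => Real.exp (-G x)) fun x => Real.exp (-G x) * -g x :=
    .of_hasDerivAt (fun x => (hG x).neg.exp) (by fun_prop)
  have hw := (h.isPrimitive_deriv hq).sub (hg.mul h.isPrimitive)
  constructor
  · refine (hexp_neg.mul h.isPrimitive).congr_density fun x _ => ?_
    have hadd : Real.exp (-2 * G x) * Real.exp (G x) = Real.exp (-G x) := by
      rw [← Real.exp_add]
      ring_nf
    linear_combination -(dy x - g x * y x) * hadd
  · refine (hexp.mul hw).congr_density fun x _ => ?_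
    have hadd : Real.exp (2 * G x) * Real.exp (-G x) = Real.exp (G x) := by
      rw [← Real.exp_add]
      ring_nf
    simp only [RCLike.ofReal_real_eq_id, id_eq]
    linear_combination -(c - z - g x ^ 2) * y x * hadd

theorem exists_primitive_sub_mean {q : ℝ → ℝ} (hq : LocallyIntegrable q volume) {ℓ : ℝ}
    (hℓ : ℓ ≠ 0) : ∃ (c : ℝ) (g : ℝ → ℝ), Continuous g ∧ IsPrimitive g (fun t => q t - c) ∧
      g 0 = 0 ∧ g ℓ = 0 := by
  set c : ℝ := (∫ t in (0 : ℝ)..ℓ, q t) / ℓ with hc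
  have hqi := intervalIntegrable_of_locallyIntegrable hq
  have hsub (a b : ℝ) : IntervalIntegrable (fun t => q t - c) volume a b :=
    (hqi a b).sub intervalIntegrable_const
  refine ⟨c, fun x => ∫ t in (0 : ℝ)..x, (q t - c), intervalIntegral.continuous_primitive hsub 0,
    ⟨fun x _ => hsub 0 x, fun x _ => by simp⟩, intervalIntegral.integral_same, ?_⟩
  beta_reduce
  rw [intervalIntegral.integral_sub (hqi 0 ℓ) intervalIntegrable_const,
    intervalIntegral.integral_const, sub_zero, smul_eq_mul, hc, mul_div_cancel₀ _ hℓ, sub_self]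

namespace FundamentalSystem

variable {q : ℝ → ℝ} (S : FundamentalSystem ℝ q) {ℓ : ℝ}

theorem exists_two_le_disc (hℓ : 0 < ℓ) : ∃ x₀, ∀ x ≤ x₀, 2 ≤ S.disc ℓ x := by
  have hq := S.locallyIntegrable
  obtain ⟨c, g, hgc, hg, hg0, hgℓ⟩ := exists_primitive_sub_mean hq hℓ.ne'
  obtain ⟨K, hK⟩ := (isCompact_Icc (a := (0 : ℝ)) (b := ℓ)).bddAbove_image (hgc.pow 2).continuousOn
  set G : ℝ → ℝ := fun x => ∫ t in (0 : ℝ)..x, g t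
  have hG (x : ℝ) : HasDerivAt G (g x) x := (hgc.integral_hasStrictDerivAt 0 x).hasDerivAt
  have hG0 : G 0 = 0 := intervalIntegral.integral_same
  refine ⟨c - K, fun x hx => ?_⟩
  have hα : ∀ t ∈ Set.Icc 0 ℓ, 0 ≤ Real.exp (-2 * G t) := fun t _ => (Real.exp_pos _).le
  have hβ : ∀ t ∈ Set.Icc 0 ℓ, 0 ≤ Real.exp (2 * G t) * (c - x - g t ^ 2) := fun t ht => by
    have hgK : g t ^ 2 ≤ K := hK (Set.mem_image_of_mem _ ht)
    exact mul_nonneg (Real.exp_pos _).le (by linarith)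
  obtain ⟨hYu, hWu⟩ := (S.solution_u x).isPrimitive_exp_mul hq hg hgc hG
  obtain ⟨hYv, hWv⟩ := (S.solution_v x).isPrimitive_exp_mul hq hg hgc hG
  have hu := hYu.le_of_cooperative hWu hα hβ (by simp [S.u_zero, hG0])
    (by simp [S.du_zero, hg0]) hℓ.le
  have hv := hWv.le_of_cooperative hYv hβ hα (by simp [S.dv_zero, hG0, hg0])
    (by simp [S.v_zero]) hℓ.le
  simp only [hG0, neg_zero, Real.exp_zero, one_mul, S.u_zero, Real.exp_neg] at hu
  simp only [hG0, hg0, hgℓ, Real.exp_zero, one_mul, zero_mul, sub_zero, S.dv_zero] at hv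
  have hexp := Real.exp_pos (G ℓ)
  rw [inv_mul_eq_div, le_div_iff₀ hexp, one_mul] at hu
  have hprod : Real.exp (G ℓ) * (2 - Real.exp (G ℓ)) ≤ Real.exp (G ℓ) * S.dv x ℓ := by
    nlinarith [sq_nonneg (Real.exp (G ℓ) - 1)]
  have hdv := le_of_mul_le_mul_left hprod hexp
  rw [disc]
  linarith

/-- The weak inequality is strict because at a touching point the discriminant would have a local
minimum, hence a critical point, and would drop below `2` next to it. -/
theorem exists_two_lt_disc (hℓ : 0 < ℓ) : ∃ x₀, ∀ x ≤ x₀, 2 < S.disc ℓ x := by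
  obtain ⟨x₀, hx₀⟩ := S.exists_two_le_disc hℓ
  refine ⟨x₀ - 1, fun x hx => (hx₀ x (by linarith)).lt_of_ne' fun hD => ?_⟩
  have hle : ∀ᶠ y in 𝓝 x, 2 ≤ S.disc ℓ y := by
    filter_upwards [Iio_mem_nhds (show x < x₀ by linarith)] with y hy using hx₀ y hy.le
  have hmin : IsLocalMin (S.disc ℓ) x := by rwa [← hD] at hle
  rcases (S.isDiscriminant_disc hℓ).mp_cases x hD with ⟨-, hcrit⟩ | ⟨-, hlt⟩
  · exact hcrit (hmin.hasDerivAt_eq_zero (S.hasDerivAt_disc hℓ.le x))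
  · obtain ⟨y, hy, hy'⟩ := ((hle.filter_mono nhdsWithin_le_nhds).and hlt).exists
    nlinarith

theorem disc_sq_lt_four (hℓ : 0 < ℓ) {lam : ℝ} (h : InStabilityInterval q ℓ lam) :
    S.disc ℓ lam ^ 2 < 4 := by
  obtain ⟨per, semi, hper, hsemi, m, hmem⟩ := h
  obtain ⟨x₀, hx₀⟩ := S.exists_two_lt_disc hℓ
  have hsq {n : ℕ} := (S.isDiscriminant_disc hℓ).sq_lt_four_of_mem (n := n) (x := lam)
    hper.1 hper.2 hsemi.1 hsemi.2 hx₀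
  exact hmem.elim (fun h => hsq (.inl h)) fun h => hsq (.inr h)

end FundamentalSystem

/-! ### Floquet solutions -/

open ComplexConjugate

theorem FundamentalSystem.translate {𝕜 : Type*} [RCLike 𝕜] {q : ℝ → ℝ} (S : FundamentalSystem 𝕜 q)
    {ℓ : ℝ} (hℓ : 0 ≤ ℓ) (hper : Function.Periodic q ℓ) {z : 𝕜} {y dy : ℝ → 𝕜}
    (h : IsHillSolution q z y dy) {x : ℝ} (hx : 0 ≤ x) :
    y (x + ℓ) = y ℓ * S.u z x + dy ℓ * S.v z x ∧
      dy (x + ℓ) = y ℓ * S.du z x + dy ℓ * S.dv z x := by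
  simpa only [zero_add] using S.eq_comb (h.comp_add_period S.locallyIntegrable hℓ hper) hx

theorem IsHillSolution.green {q : ℝ → ℝ} (hq : LocallyIntegrable q volume) {z : ℂ}
    {y dy : ℝ → ℂ} (h : IsHillSolution q z y dy) {x : ℝ} (hx : 0 ≤ x) :
    (conj (y x) * dy x).im = (conj (y 0) * dy 0).im - z.im * ∫ t in (0 : ℝ)..x, ‖y t‖ ^ 2 := by
  have hp : IsPrimitive (fun x => (conj (y x) * dy x).im) fun x => -z.im * ‖y x‖ ^ 2 := by
    refine (h.isPrimitive.conj.mul (h.isPrimitive_deriv hq)).im.congr_density fun x _ => ?_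
    rw [← Complex.normSq_eq_norm_sq, Complex.normSq_apply]
    simp
    ring
  rw [hp.eq x hx, intervalIntegral.integral_const_mul]
  ring

theorem IsHillSolution.aestronglyMeasurable {𝕜 : Type*} [RCLike 𝕜] {q : ℝ → ℝ} {z : 𝕜}
    {y dy : ℝ → 𝕜} (h : IsHillSolution q z y dy) :
    AEStronglyMeasurable y (volume.restrict (Set.Ioi 0)) :=
  (h.continuousOn.mono Set.Ioi_subset_Ici_self).aestronglyMeasurable measurableSet_Ioi

/-- `(y, dy)` is a Floquet solution with multiplier `τ`: going through a period multiplies it by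
`τ`. It suffices to require this of the initial data. -/
structure IsFloquetSolution {𝕜 : Type*} [RCLike 𝕜] (q : ℝ → ℝ) (ℓ : ℝ) (z τ : 𝕜)
    (y dy : ℝ → 𝕜) : Prop extends IsHillSolution q z y dy where
  apply_period : y ℓ = τ * y 0
  deriv_period : dy ℓ = τ * dy 0

namespace IsFloquetSolution

theorem apply_nat_mul {𝕜 : Type*} [RCLike 𝕜] {q : ℝ → ℝ} {ℓ : ℝ} {z τ : 𝕜} {y dy : ℝ → 𝕜}
    (hq : LocallyIntegrable q volume) (hℓ : 0 ≤ ℓ) (hper : Function.Periodic q ℓ)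
    (h : IsFloquetSolution q ℓ z τ y dy) (n : ℕ) :
    y (n * ℓ) = τ ^ n * y 0 ∧ dy (n * ℓ) = τ ^ n * dy 0 := by
  obtain ⟨S⟩ := FundamentalSystem.nonempty (𝕜 := 𝕜) hq
  induction n with
  | zero => simp
  | succ n ih =>
    have hn : 0 ≤ n * ℓ := by positivity
    obtain ⟨hy, hdy⟩ := S.translate hℓ hper h.toIsHillSolution hn
    obtain ⟨hy', hdy'⟩ := S.eq_comb h.toIsHillSolution hn
    rw [ih.1] at hy'
    rw [ih.2] at hdy'
    rw [Nat.cast_add_one, add_one_mul, hy, hdy, h.apply_period, h.deriv_period]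
    constructor
    · linear_combination (-τ) * hy'
    · linear_combination (-τ) * hdy'

variable {q : ℝ → ℝ} {ℓ : ℝ} {z τ : ℂ} {y dy : ℝ → ℂ} (hq : LocallyIntegrable q volume)
  (hℓ : 0 < ℓ) (h : IsFloquetSolution q ℓ z τ y dy)
include hq hℓ h

theorem wronskian_conj_pos (hz : 0 < z.im) (h0 : ¬(y 0 = 0 ∧ dy 0 = 0)) :
    0 < (1 - ‖τ‖ ^ 2) * (conj (y 0) * dy 0).im := by
  have hgreen := h.green hq hℓ.le
  have hτ : conj (τ * y 0) * (τ * dy 0) = ((‖τ‖ ^ 2 : ℝ) : ℂ) * (conj (y 0) * dy 0) := by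
    rw [map_mul, mul_mul_mul_comm, Complex.conj_mul', Complex.ofReal_pow]
  rw [h.apply_period, h.deriv_period, hτ, Complex.im_ofReal_mul] at hgreen
  linarith [mul_pos hz (h.integral_norm_sq_pos hℓ h0)]

variable (hper : Function.Periodic q ℓ)
include hper

theorem integral_norm_sq (n : ℕ) :
    z.im * ∫ t in (0 : ℝ)..n * ℓ, ‖y t‖ ^ 2 =
      (1 - (‖τ‖ ^ 2) ^ n) * (conj (y 0) * dy 0).im := by
  have hgreen := h.green hq (x := n * ℓ) (by positivity)
  obtain ⟨hy, hdy⟩ := h.apply_nat_mul hq hℓ.le hper n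
  have hτ : conj (τ ^ n * y 0) * (τ ^ n * dy 0) =
      (((‖τ‖ ^ 2) ^ n : ℝ) : ℂ) * (conj (y 0) * dy 0) := by
    rw [map_mul, map_pow, mul_mul_mul_comm, ← mul_pow, Complex.conj_mul', Complex.ofReal_pow,
      Complex.ofReal_pow]
  rw [hy, hdy, hτ, Complex.im_ofReal_mul] at hgreen
  linarith

theorem memLp (hz : 0 < z.im) (hτ : ‖τ‖ < 1) : MemLp y 2 (volume.restrict (Set.Ioi 0)) := by
  rw [memLp_two_iff_integrable_sq_norm h.aestronglyMeasurable]
  refine integrableOn_Ioi_of_intervalIntegral_norm_bounded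
    (|(conj (y 0) * dy 0).im| / z.im) 0 (l := atTop) (b := fun n : ℕ => n * ℓ) (fun n => ?_)
    (tendsto_natCast_atTop_atTop.atTop_mul_const hℓ) (Eventually.of_forall fun n => ?_)
  · refine (ContinuousOn.integrableOn_Icc ?_).mono_set Set.Ioc_subset_Icc_self
    exact (h.continuousOn.mono Set.Icc_subset_Ici_self).norm.pow 2
  · have hpow : (‖τ‖ ^ 2) ^ n ≤ 1 :=
      pow_le_one₀ (by positivity) (pow_le_one₀ (norm_nonneg _) hτ.le)
    have habs : |1 - (‖τ‖ ^ 2) ^ n| ≤ 1 := by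
      rw [abs_of_nonneg (sub_nonneg.2 hpow)]
      exact sub_le_self _ (by positivity)
    simp only [norm_pow, norm_norm]
    rw [le_div_iff₀ hz, mul_comm, h.integral_norm_sq hq hℓ hper n]
    refine (le_abs_self _).trans ?_
    rw [abs_mul]
    exact mul_le_of_le_one_left (abs_nonneg _) habs

theorem not_memLp (hz : 0 < z.im) (hτ : 1 < ‖τ‖) (h0 : ¬(y 0 = 0 ∧ dy 0 = 0)) :
    ¬MemLp y 2 (volume.restrict (Set.Ioi 0)) := by
  rw [memLp_two_iff_integrable_sq_norm h.aestronglyMeasurable]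
  intro hintegral
  have hsq : 1 < ‖τ‖ ^ 2 := one_lt_pow₀ hτ two_ne_zero
  have hneg : (conj (y 0) * dy 0).im < 0 := by nlinarith [h.wronskian_conj_pos hq hℓ hz h0]
  have hle (n : ℕ) : ∫ t in (0 : ℝ)..n * ℓ, ‖y t‖ ^ 2 ≤ ∫ t in Set.Ioi 0, ‖y t‖ ^ 2 := by
    rw [intervalIntegral.integral_of_le (by positivity)]
    exact setIntegral_mono_set hintegral (Eventually.of_forall fun t => by positivity)
      (LE.le.eventuallyLE Set.Ioc_subset_Ioi_self)
  obtain ⟨n, hn⟩ := pow_unbounded_of_one_lt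
    (1 + z.im * (∫ t in Set.Ioi 0, ‖y t‖ ^ 2) / -(conj (y 0) * dy 0).im) hsq
  have hbound := mul_le_mul_of_nonneg_left (hle n) hz.le
  rw [h.integral_norm_sq hq hℓ hper n] at hbound
  rw [← lt_sub_iff_add_lt', div_lt_iff₀ (neg_pos.2 hneg)] at hn
  linarith

end IsFloquetSolution

/-! ### The Titchmarsh–Weyl coefficient of a periodic equation -/

section Rotation

variable {α : ℝ} {a b : ℂ}

theorem im_conj_rotation_mul (α : ℝ) (a b : ℂ) :
    (conj (Real.cos α * a + Real.sin α * b) * (Real.cos α * b - Real.sin α * a)).im =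
      (conj a * b).im := by
  simp only [Complex.sub_re, Complex.sub_im, Complex.add_re, Complex.add_im, Complex.mul_re,
    Complex.mul_im, Complex.ofReal_re, Complex.ofReal_im, Complex.conj_re, Complex.conj_im]
  linear_combination (a.re * b.im - a.im * b.re) * Real.sin_sq_add_cos_sq α

theorem rotation_ne_zero (h : (conj a * b).im ≠ 0) : Real.cos α * a + Real.sin α * b ≠ 0 :=
  fun h0 => h (by rw [← im_conj_rotation_mul α, h0, map_zero, zero_mul, Complex.zero_im])

end Rotation

namespace FundamentalSystem

variable {q : ℝ → ℝ} (S : FundamentalSystem ℂ q) {ℓ : ℝ} {z τ m : ℂ}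

/-- `τ` is the eigenvalue of the monodromy matrix of modulus less than `1`, which is the multiplier
of a Floquet solution that decays at infinity. -/
structure IsDecayingMultiplier (ℓ : ℝ) (z τ : ℂ) : Prop where
  root : τ ^ 2 - S.disc ℓ z * τ + 1 = 0
  norm_lt_one : ‖τ‖ < 1

/-- The quotient `y' 0 / y 0` of the Floquet solution with multiplier `τ`, in the coordinates
rotated by `α`. For the decaying multiplier this is the Titchmarsh–Weyl coefficient. -/
noncomputable def weylFormula (ℓ α : ℝ) (z τ : ℂ) : ℂ :=
  (Real.cos α * (τ - S.u z ℓ) - Real.sin α * S.v z ℓ) /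
    (Real.cos α * S.v z ℓ + Real.sin α * (τ - S.u z ℓ))

theorem weylFormula_im (ℓ α : ℝ) (z τ : ℂ) : (S.weylFormula ℓ α z τ).im =
    (conj (S.v z ℓ) * (τ - S.u z ℓ)).im /
      Complex.normSq (Real.cos α * S.v z ℓ + Real.sin α * (τ - S.u z ℓ)) := by
  rw [weylFormula, ← im_conj_rotation_mul α, Complex.div_im, ← sub_div]
  simp only [Complex.mul_im, Complex.conj_re, Complex.conj_im]
  ring

theorem continuousOn_weylFormula {τ : ℂ → ℂ} {s : Set ℂ} (α : ℝ) (hτ : ContinuousOn τ s)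
    (h : ∀ z ∈ s, (conj (S.v z ℓ) * (τ z - S.u z ℓ)).im ≠ 0) :
    ContinuousOn (fun z => S.weylFormula ℓ α z (τ z)) s := by
  have hu := (S.continuous_u.uncurry_right ℓ).continuousOn (s := s)
  have hv := (S.continuous_v.uncurry_right ℓ).continuousOn (s := s)
  exact (((hτ.sub hu).const_mul _).sub (hv.const_mul _)).div
    ((hv.const_mul _).add ((hτ.sub hu).const_mul _)) fun z hz => rotation_ne_zero (h z hz)

theorem isFloquetSolution (hℓ : 0 ≤ ℓ) (hτ : τ ^ 2 - S.disc ℓ z * τ + 1 = 0) :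
    IsFloquetSolution q ℓ z τ (fun x => S.v z ℓ * S.u z x + (τ - S.u z ℓ) * S.v z x)
      (fun x => S.v z ℓ * S.du z x + (τ - S.u z ℓ) * S.dv z x) where
  toIsHillSolution := (S.solution_u z).linear_comb S.locallyIntegrable (S.solution_v z) _ _
  apply_period := by
    rw [S.u_zero, S.v_zero]
    ring
  deriv_period := by
    rw [disc] at hτ
    rw [S.du_zero, S.dv_zero]
    linear_combination -S.wronskian z hℓ - hτ

theorem inv_root (hτ : τ ^ 2 - S.disc ℓ z * τ + 1 = 0) :
    τ⁻¹ ^ 2 - S.disc ℓ z * τ⁻¹ + 1 = 0 := by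
  have hτ0 : τ ≠ 0 := fun h => by simp [h] at hτ
  field_simp
  linear_combination hτ

section UpperHalfPlane

variable (hℓ : 0 < ℓ) (hz : 0 < z.im)
include hℓ hz

theorem v_ne_zero_of_im_pos : S.v z ℓ ≠ 0 := fun h0 => by
  have hgreen := (S.solution_v z).green S.locallyIntegrable hℓ.le
  have hpos := (S.solution_v z).integral_norm_sq_pos hℓ (by simp [S.dv_zero])
  rw [h0, S.v_zero] at hgreen
  simp only [map_zero, zero_mul, Complex.zero_im, zero_sub] at hgreen
  nlinarith

theorem floquet_wronskian_conj_pos (hτ : τ ^ 2 - S.disc ℓ z * τ + 1 = 0) :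
    0 < (1 - ‖τ‖ ^ 2) * (conj (S.v z ℓ) * (τ - S.u z ℓ)).im := by
  simpa [S.u_zero, S.v_zero, S.du_zero, S.dv_zero, S.v_ne_zero_of_im_pos hℓ hz] using
    (S.isFloquetSolution hℓ.le hτ).wronskian_conj_pos S.locallyIntegrable hℓ hz

theorem norm_ne_one (hτ : τ ^ 2 - S.disc ℓ z * τ + 1 = 0) : ‖τ‖ ≠ 1 := fun h1 => by
  simpa [h1] using S.floquet_wronskian_conj_pos hℓ hz hτ

variable {S}

theorem IsDecayingMultiplier.im_pos (hτ : S.IsDecayingMultiplier ℓ z τ) :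
    0 < (conj (S.v z ℓ) * (τ - S.u z ℓ)).im :=
  pos_of_mul_pos_right (S.floquet_wronskian_conj_pos hℓ hz hτ.root)
    (sub_nonneg.2 (pow_le_one₀ (norm_nonneg _) hτ.norm_lt_one.le))

variable (hper : Function.Periodic q ℓ) (hτ : S.IsDecayingMultiplier ℓ z τ) {α : ℝ}
include hper hτ

theorem IsDecayingMultiplier.isWeylCoefficient (α : ℝ) :
    IsWeylCoefficient q α z (S.weylFormula ℓ α z τ) := by
  have hden := rotation_ne_zero (α := α) (hτ.im_pos hℓ hz).ne'
  have hLp := (S.isFloquetSolution hℓ.le hτ.root).memLp S.locallyIntegrable hℓ hper hz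
    hτ.norm_lt_one
  have hsc : (Real.sin α : ℂ) ^ 2 + (Real.cos α : ℂ) ^ 2 = 1 := by
    exact_mod_cast Real.sin_sq_add_cos_sq α
  have hcomb := (S.solution_u z).linear_comb S.locallyIntegrable (S.solution_v z)
  refine ⟨_, _, _, _, hcomb (Real.cos α) (Real.sin α), hcomb (-Real.sin α) (Real.cos α),
    by simp [S.u_zero, S.v_zero], by simp [S.du_zero, S.dv_zero], by simp [S.u_zero, S.v_zero],
    by simp [S.du_zero, S.dv_zero], ?_⟩
  convert hLp.const_mul (Real.cos α * S.v z ℓ + Real.sin α * (τ - S.u z ℓ))⁻¹ using 2 with x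
  rw [weylFormula, eq_inv_mul_iff_mul_eq₀ hden, div_mul_eq_mul_div, mul_add, mul_div_cancel₀ _ hden]
  linear_combination (S.v z ℓ * S.u z x + (τ - S.u z ℓ) * S.v z x) * hsc

-- Otherwise the Floquet solution with multiplier `τ⁻¹`, which is not square integrable, would be a
-- linear combination of `y` and of the one with multiplier `τ`.
theorem IsDecayingMultiplier.initial_eq_of_memLp {y dy : ℝ → ℂ} (h : IsHillSolution q z y dy)
    (hL : MemLp y 2 (volume.restrict (Set.Ioi 0))) : y 0 * (τ - S.u z ℓ) = dy 0 * S.v z ℓ := by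
  have hq := S.locallyIntegrable
  have hτ0 : τ ≠ 0 := fun h => by simpa [h] using hτ.root
  have hinv : 1 < ‖τ⁻¹‖ := by
    rw [norm_inv]
    exact (one_lt_inv₀ (norm_pos_iff.2 hτ0)).2 hτ.norm_lt_one
  have hLτ := (S.isFloquetSolution hℓ.le hτ.root).memLp hq hℓ hper hz hτ.norm_lt_one
  have hnot := (S.isFloquetSolution hℓ.le (S.inv_root hτ.root)).not_memLp hq hℓ hper hz hinv
    fun h0 => S.v_ne_zero_of_im_pos hℓ hz (by simpa [S.u_zero, S.v_zero] using h0.1)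
  by_contra hne
  refine hnot ((((hL.const_mul (S.v z ℓ * (τ - τ⁻¹))).add
    (hLτ.const_mul (y 0 * (τ⁻¹ - S.u z ℓ) - dy 0 * S.v z ℓ))).const_mul
      (y 0 * (τ - S.u z ℓ) - dy 0 * S.v z ℓ)⁻¹).ae_eq ?_)
  filter_upwards [ae_restrict_mem measurableSet_Ioi] with x hx
  simp only [Pi.add_apply]
  rw [(S.eq_comb h (le_of_lt hx)).1, inv_mul_eq_iff_eq_mul₀ (sub_ne_zero.2 hne)]
  ring

theorem IsDecayingMultiplier.eq_weylFormula (hm : IsWeylCoefficient q α z m) :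
    m = S.weylFormula ℓ α z τ := by
  obtain ⟨θ, dθ, φ, dφ, hθ, hφ, hθ0, hdθ0, hφ0, hdφ0, hL⟩ := hm
  have hinit := hτ.initial_eq_of_memLp hℓ hz hper (hθ.linear_comb S.locallyIntegrable hφ 1 m)
    (by simpa only [one_mul] using hL)
  rw [hθ0, hdθ0, hφ0, hdφ0] at hinit
  rw [weylFormula, eq_div_iff (rotation_ne_zero (hτ.im_pos hℓ hz).ne')]
  linear_combination -hinit

theorem IsDecayingMultiplier.weylM_eq (α : ℝ) : weylM q α z = S.weylFormula ℓ α z τ :=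
  hτ.eq_weylFormula hℓ hz hper
    (Classical.epsilon_spec ⟨_, hτ.isWeylCoefficient hℓ hz hper α⟩)

theorem IsDecayingMultiplier.weylM_im_pos (α : ℝ) : 0 < (weylM q α z).im := by
  rw [hτ.weylM_eq hℓ hz hper, weylFormula_im]
  exact div_pos (hτ.im_pos hℓ hz)
    (Complex.normSq_pos.2 (rotation_ne_zero (hτ.im_pos hℓ hz).ne'))

end UpperHalfPlane

end FundamentalSystem

/-! ### Boundary values of the Titchmarsh–Weyl coefficient -/

/-- The roots `τ` of `τ ^ 2 - d * τ + 1`, one for each choice of the sign `σ = ±1`. In this form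
they are continuous in `d` near the real interval `(-2, 2)`. -/
noncomputable def multiplier (σ : ℝ) (d : ℂ) : ℂ :=
  (d + σ * Complex.I * (4 - d ^ 2) ^ (2⁻¹ : ℂ)) / 2

theorem multiplier_root {σ : ℝ} (hσ : σ ^ 2 = 1) (d : ℂ) :
    multiplier σ d ^ 2 - d * multiplier σ d + 1 = 0 := by
  have hsqrt : ((4 - d ^ 2) ^ (2⁻¹ : ℂ)) ^ 2 = 4 - d ^ 2 := Complex.cpow_ofNat_inv_pow _ 2
  have hσ' : (σ : ℂ) ^ 2 = 1 := by exact_mod_cast hσ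
  rw [multiplier]
  linear_combination (Complex.I ^ 2 / 4) * hsqrt + (4 - d ^ 2) / 4 * Complex.I_sq
    + (((4 - d ^ 2) ^ (2⁻¹ : ℂ)) ^ 2 * Complex.I ^ 2 / 4) * hσ'

theorem multiplier_one_mul_multiplier_neg_one (d : ℂ) : multiplier 1 d * multiplier (-1) d = 1 := by
  have hsqrt : ((4 - d ^ 2) ^ (2⁻¹ : ℂ)) ^ 2 = 4 - d ^ 2 := Complex.cpow_ofNat_inv_pow _ 2
  simp only [multiplier, Complex.ofReal_neg, Complex.ofReal_one]
  linear_combination (-(Complex.I ^ 2) / 4) * hsqrt - (4 - d ^ 2) / 4 * Complex.I_sq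

theorem continuousOn_multiplier (σ : ℝ) :
    ContinuousOn (multiplier σ) {d | 4 - d ^ 2 ∈ Complex.slitPlane} := by
  have hcont : ContinuousOn (fun d : ℂ => 4 - d ^ 2) {d | 4 - d ^ 2 ∈ Complex.slitPlane} := by
    fun_prop
  exact (continuousOn_id.add ((hcont.cpow_const fun _ h => h).const_mul _)).div_const 2

theorem multiplier_ofReal (σ : ℝ) {d : ℝ} (hd : d ^ 2 < 4) :
    multiplier σ d = (d / 2 : ℝ) + (σ * √(4 - d ^ 2) / 2 : ℝ) * Complex.I := by
  have hsqrt : (4 - (d : ℂ) ^ 2) ^ (2⁻¹ : ℂ) = (√(4 - d ^ 2) : ℝ) := by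
    rw [Real.sqrt_eq_rpow, Complex.ofReal_cpow (by linarith)]
    norm_num
  rw [multiplier, hsqrt]
  push_cast
  ring

theorem norm_sub_mul_le_of_root {d e t s : ℂ} (ht : t ^ 2 - d * t + 1 = 0)
    (hs : s ^ 2 - e * s + 1 = 0) (hs1 : ‖s‖ ≤ 1) : ‖s - t‖ * (‖t⁻¹‖ - 1) ≤ ‖e - d‖ := by
  have ht0 : t ≠ 0 := fun h => by simp [h] at ht
  have hfactor : (s - t) * (s - t⁻¹) = (e - d) * s := by
    field_simp
    linear_combination t * hs - s * ht
  calc ‖s - t‖ * (‖t⁻¹‖ - 1) ≤ ‖s - t‖ * ‖s - t⁻¹‖ := by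
        gcongr
        linarith [norm_sub_norm_le t⁻¹ s, norm_sub_rev t⁻¹ s]
    _ = ‖e - d‖ * ‖s‖ := by rw [← norm_mul, hfactor, norm_mul]
    _ ≤ ‖e - d‖ := mul_le_of_le_one_right (norm_nonneg _) hs1

theorem continuousOn_root_of_norm_lt_one {X : Type*} [TopologicalSpace X] {D τ : X → ℂ} {s : Set X}
    (hD : ContinuousOn D s) (hroot : ∀ x ∈ s, τ x ^ 2 - D x * τ x + 1 = 0)
    (hlt : ∀ x ∈ s, ‖τ x‖ < 1) : ContinuousOn τ s := fun x hx => by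
  have hτ0 : τ x ≠ 0 := fun h => by simpa [h] using hroot x hx
  have hgap : 0 < ‖(τ x)⁻¹‖ - 1 := by
    rw [norm_inv, sub_pos]
    exact (one_lt_inv₀ (norm_pos_iff.2 hτ0)).2 (hlt x hx)
  have hlim := (tendsto_iff_norm_sub_tendsto_zero.1 (hD x hx)).div_const (‖(τ x)⁻¹‖ - 1)
  rw [zero_div] at hlim
  refine tendsto_iff_norm_sub_tendsto_zero.2
    (squeeze_zero' (Eventually.of_forall fun _ => norm_nonneg _) ?_ hlim)
  filter_upwards [self_mem_nhdsWithin] with y hy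
  rw [le_div_iff₀ hgap]
  exact norm_sub_mul_le_of_root (hroot x hx) (hroot y hy) (hlt y hy).le

namespace FundamentalSystem

section UpperHalfPlane

variable {q : ℝ → ℝ} (S : FundamentalSystem ℂ q) {ℓ : ℝ} (hℓ : 0 < ℓ)
include hℓ

theorem exists_isDecayingMultiplier {z : ℂ} (hz : 0 < z.im) :
    ∃ τ, S.IsDecayingMultiplier ℓ z τ := by
  have hroot := multiplier_root (σ := 1) (by norm_num) (S.disc ℓ z)
  rcases (S.norm_ne_one hℓ hz hroot).lt_or_gt with hlt | hgt
  · exact ⟨_, hroot, hlt⟩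
  · refine ⟨_, S.inv_root hroot, ?_⟩
    rw [norm_inv]
    exact inv_lt_one_of_one_lt₀ hgt

theorem exists_isDecayingMultiplier_multiplier {s : Set ℂ} (hs : IsPreconnected s)
    (him : ∀ z ∈ s, 0 < z.im) (hslit : ∀ z ∈ s, 4 - S.disc ℓ z ^ 2 ∈ Complex.slitPlane) :
    ∃ σ : ℝ, σ ^ 2 = 1 ∧ ∀ z ∈ s, S.IsDecayingMultiplier ℓ z (multiplier σ (S.disc ℓ z)) := by
  have hroot {σ : ℝ} (hσ : σ ^ 2 = 1) (z : ℂ) := multiplier_root hσ (S.disc ℓ z)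
  obtain ⟨σ, hσ, hlt⟩ :
      ∃ σ : ℝ, σ ^ 2 = 1 ∧ ∀ z ∈ s, ‖multiplier σ (S.disc ℓ z)‖ < 1 := by
    by_contra! hcon
    obtain ⟨z₁, hz₁, h₁⟩ := hcon 1 (by norm_num)
    obtain ⟨z₂, hz₂, h₂⟩ := hcon (-1) (by norm_num)
    have h₃ : ‖multiplier 1 (S.disc ℓ z₂)‖ ≤ 1 := by
      have hnorm := congrArg norm (multiplier_one_mul_multiplier_neg_one (S.disc ℓ z₂))
      rw [norm_mul, norm_one] at hnorm
      nlinarith [norm_nonneg (multiplier 1 (S.disc ℓ z₂))]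
    have hcont := (continuousOn_multiplier 1).comp (S.continuous_disc ℓ).continuousOn hslit
    obtain ⟨w, hw, hw1⟩ := hs.intermediate_value hz₂ hz₁ hcont.norm ⟨h₃, h₁⟩
    exact S.norm_ne_one hℓ (him w hw) (hroot (by norm_num) w) hw1
  exact ⟨σ, hσ, fun z hz => ⟨hroot hσ z, hlt z hz⟩⟩

end UpperHalfPlane

end FundamentalSystem

section UpperHalfPlane

variable {q : ℝ → ℝ} (hq : LocallyIntegrable q volume) {ℓ : ℝ} (hℓ : 0 < ℓ)
  (hper : Function.Periodic q ℓ) (α : ℝ)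
include hq hℓ hper

theorem continuousOn_weylM : ContinuousOn (weylM q α) {z | 0 < z.im} := by
  obtain ⟨S⟩ := FundamentalSystem.nonempty (𝕜 := ℂ) hq
  choose! τ hτ using fun z hz => S.exists_isDecayingMultiplier (z := z) hℓ hz
  have hcont : ContinuousOn τ {z | 0 < z.im} :=
    continuousOn_root_of_norm_lt_one (S.continuous_disc ℓ).continuousOn
      (fun z hz => (hτ z hz).root) fun z hz => (hτ z hz).norm_lt_one
  exact (S.continuousOn_weylFormula α hcont fun z hz => ((hτ z hz).im_pos hℓ hz).ne').congr
    fun z hz => (hτ z hz).weylM_eq hℓ hz hper α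

theorem weylM_im_pos {z : ℂ} (hz : 0 < z.im) : 0 < (weylM q α z).im := by
  obtain ⟨S⟩ := FundamentalSystem.nonempty (𝕜 := ℂ) hq
  obtain ⟨τ, hτ⟩ := S.exists_isDecayingMultiplier hℓ hz
  exact hτ.weylM_im_pos hℓ hz hper α

end UpperHalfPlane

namespace FundamentalSystem

section General

variable {𝕜 : Type*} [RCLike 𝕜] {q : ℝ → ℝ} (S : FundamentalSystem 𝕜 q)

/-- The quadratic form in the data `(y, y')` that the monodromy matrix preserves. Its discriminant
is `disc ^ 2 - 4`. -/
def monodromyForm (ℓ : ℝ) (z y dy : 𝕜) : 𝕜 :=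
  S.v z ℓ * dy ^ 2 + (S.u z ℓ - S.dv z ℓ) * y * dy - S.du z ℓ * y ^ 2

end General

variable {q : ℝ → ℝ} (S : FundamentalSystem ℂ q) (T : FundamentalSystem ℝ q) {ℓ : ℝ}

theorem ofReal_eq (x : ℝ) {t : ℝ} (ht : 0 ≤ t) :
    S.u x t = T.u x t ∧ S.du x t = T.du x t ∧ S.v x t = T.v x t ∧ S.dv x t = T.dv x t := by
  have hq := S.locallyIntegrable
  obtain ⟨hu, hdu⟩ := (S.solution_u x).eq_of_initial_eq hq ((T.solution_u x).ofReal hq)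
    (by simp [S.u_zero, T.u_zero]) (by simp [S.du_zero, T.du_zero]) ht
  obtain ⟨hv, hdv⟩ := (S.solution_v x).eq_of_initial_eq hq ((T.solution_v x).ofReal hq)
    (by simp [S.v_zero, T.v_zero]) (by simp [S.dv_zero, T.dv_zero]) ht
  exact ⟨hu, hdu, hv, hdv⟩

variable (hℓ : 0 ≤ ℓ)
include hℓ

theorem disc_ofReal (x : ℝ) : S.disc ℓ x = T.disc ℓ x := by
  rw [disc, disc, (S.ofReal_eq T x hℓ).1, (S.ofReal_eq T x hℓ).2.2.2, Complex.ofReal_add]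

theorem four_sub_disc_sq_mem_slitPlane_iff (x : ℝ) :
    4 - S.disc ℓ x ^ 2 ∈ Complex.slitPlane ↔ T.disc ℓ x ^ 2 < 4 := by
  rw [S.disc_ofReal T hℓ, ← sub_pos (b := T.disc ℓ x ^ 2), ← Complex.ofReal_mem_slitPlane]
  norm_cast

variable {x : ℝ} (hx : T.disc ℓ x ^ 2 < 4) (σ : ℝ)
include hx

theorem multiplier_sub_u :
    multiplier σ (S.disc ℓ x) - S.u x ℓ = ((T.dv x ℓ - T.u x ℓ) / 2 : ℝ)
      + (σ * √(4 - T.disc ℓ x ^ 2) / 2 : ℝ) * Complex.I := by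
  rw [S.disc_ofReal T hℓ, multiplier_ofReal σ hx, (S.ofReal_eq T x hℓ).1, add_sub_right_comm,
    ← Complex.ofReal_sub, disc]
  ring_nf

theorem im_conj_v_mul_multiplier_sub_u :
    (conj (S.v x ℓ) * (multiplier σ (S.disc ℓ x) - S.u x ℓ)).im =
      T.v x ℓ * (σ * √(4 - T.disc ℓ x ^ 2) / 2) := by
  rw [S.multiplier_sub_u T hℓ hx σ, (S.ofReal_eq T x hℓ).2.2.1, Complex.conj_ofReal,
    Complex.im_ofReal_mul]
  simp

variable {σ} (hσ : σ ^ 2 = 1)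
include hσ

theorem im_conj_v_mul_multiplier_sub_u_ne_zero :
    (conj (S.v x ℓ) * (multiplier σ (S.disc ℓ x) - S.u x ℓ)).im ≠ 0 := by
  have hσ0 : σ ≠ 0 := fun h => by simp [h] at hσ
  rw [S.im_conj_v_mul_multiplier_sub_u T hℓ hx]
  exact mul_ne_zero (T.v_ne_zero hℓ hx)
    (div_ne_zero (mul_ne_zero hσ0 (Real.sqrt_pos.2 (sub_pos.2 hx)).ne') two_ne_zero)

theorem normSq_rotation_multiplier_sub_u (α : ℝ) :
    Complex.normSq (Real.cos α * S.v x ℓ + Real.sin α * (multiplier σ (S.disc ℓ x) - S.u x ℓ)) =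
      T.v x ℓ * T.monodromyForm ℓ x (-Real.sin α) (Real.cos α) := by
  rw [S.multiplier_sub_u T hℓ hx σ, (S.ofReal_eq T x hℓ).2.2.1, Complex.normSq_apply,
    monodromyForm]
  simp only [Complex.add_re, Complex.add_im, Complex.mul_re, Complex.mul_im, Complex.ofReal_re,
    Complex.ofReal_im, Complex.I_re, Complex.I_im]
  linear_combination (Real.sin α ^ 2 * √(4 - T.disc ℓ x ^ 2) ^ 2 / 4) * hσ
    + (Real.sin α ^ 2 / 4) * Real.sq_sqrt (sub_pos.2 hx).le
    - (Real.sin α ^ 2 / 4) * T.disc_sq_sub_four hℓ x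

theorem abs_im_weylFormula_multiplier (α : ℝ) :
    |(S.weylFormula ℓ α x (multiplier σ (S.disc ℓ x))).im| =
      √(4 - T.disc ℓ x ^ 2) / 2 / |T.monodromyForm ℓ x (-Real.sin α) (Real.cos α)| := by
  have hσ1 : |σ| = 1 := by
    rw [← pow_eq_one_iff_of_nonneg (abs_nonneg σ) two_ne_zero, sq_abs, hσ]
  rw [weylFormula_im, S.im_conj_v_mul_multiplier_sub_u T hℓ hx,
    S.normSq_rotation_multiplier_sub_u T hℓ hx hσ, mul_div_mul_left _ _ (T.v_ne_zero hℓ hx),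
    abs_div, abs_div, abs_mul, hσ1, one_mul, abs_of_nonneg (Real.sqrt_nonneg _), abs_two]

end FundamentalSystem

/-- `F` extends `m` continuously from the upper half-plane to the real interval of radius `η`
around `lam`. The extension is required on a closed rectangle, whose compactness bounds `F`. -/
structure IsBoundaryExtension (m F : ℂ → ℂ) (lam η : ℝ) : Prop where
  pos : 0 < η
  continuousOn : ContinuousOn F (Set.Icc (lam - η) (lam + η) ×ℂ Set.Icc 0 η)
  eq : ∀ z ∈ Set.Icc (lam - η) (lam + η) ×ℂ Set.Ioc 0 η, m z = F z

theorem ofReal_add_mul_I_mem_reProdIm_iff {s t : Set ℝ} {x y : ℝ} :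
    (x : ℂ) + y * Complex.I ∈ s ×ℂ t ↔ x ∈ s ∧ y ∈ t := by
  simp [Complex.mem_reProdIm]

theorem ofReal_mem_reProdIm_iff {s t : Set ℝ} {x : ℝ} : (x : ℂ) ∈ s ×ℂ t ↔ x ∈ s ∧ 0 ∈ t := by
  simp [Complex.mem_reProdIm]

theorem isPreconnected_reProdIm {s t : Set ℝ} (hs : Convex ℝ s) (ht : Convex ℝ t) :
    IsPreconnected (s ×ℂ t) :=
  ((hs.linear_preimage Complex.reLm).inter (ht.linear_preimage Complex.imLm)).isPreconnected

theorem continuous_im_horizontal {m : ℂ → ℂ} (hm : ContinuousOn m {z | 0 < z.im}) {ε : ℝ}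
    (hε : 0 < ε) : Continuous fun t : ℝ => (m (t + ε * Complex.I)).im :=
  Complex.continuous_im.comp (hm.comp_continuous (by fun_prop) fun t => by simpa using hε)

namespace IsBoundaryExtension

variable {m F : ℂ → ℂ} {lam η : ℝ} (h : IsBoundaryExtension m F lam η)
include h

theorem center_mem_Ioo : lam ∈ Set.Ioo (lam - η) (lam + η) :=
  ⟨by linarith [h.pos], by linarith [h.pos]⟩

theorem tendsto {t : ℝ} (ht : t ∈ Set.Icc (lam - η) (lam + η)) :
    Tendsto (fun ε : ℝ => (m (t + ε * Complex.I)).im) (𝓝[>] 0) (𝓝 (F t).im) := by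
  have hline : Tendsto (fun ε : ℝ => (t : ℂ) + ε * Complex.I) (𝓝[>] 0)
      (𝓝[Set.Icc (lam - η) (lam + η) ×ℂ Set.Icc 0 η] (t : ℂ)) := by
    refine tendsto_nhdsWithin_iff.2 ⟨?_, ?_⟩
    · have hcont : Continuous fun ε : ℝ => (t : ℂ) + ε * Complex.I := by fun_prop
      simpa using (hcont.tendsto 0).mono_left (nhdsWithin_le_nhds (s := Set.Ioi 0))
    · filter_upwards [Ioc_mem_nhdsGT h.pos] with ε hε
      exact ofReal_add_mul_I_mem_reProdIm_iff.2 ⟨ht, hε.1.le, hε.2⟩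
  have hF := (h.continuousOn t (ofReal_mem_reProdIm_iff.2 ⟨ht, le_rfl, h.pos.le⟩)).tendsto
  refine ((Complex.continuous_im.tendsto _).comp (hF.comp hline)).congr' ?_
  filter_upwards [Ioc_mem_nhdsGT h.pos] with ε hε
  rw [Function.comp_apply, Function.comp_apply,
    h.eq _ (ofReal_add_mul_I_mem_reProdIm_iff.2 ⟨ht, hε⟩)]

theorem tendsto_integral {μ : ℝ} (hm : ContinuousOn m {z | 0 < z.im})
    (hμ : μ ∈ Set.Icc (lam - η) (lam + η)) :
    Tendsto (fun ε : ℝ => ∫ t in lam..μ, (m (t + ε * Complex.I)).im) (𝓝[>] 0)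
      (𝓝 (∫ t in lam..μ, (F t).im)) := by
  have hsub : Set.uIoc lam μ ⊆ Set.Icc (lam - η) (lam + η) :=
    Set.uIoc_subset_uIcc.trans (Set.uIcc_subset_Icc (Set.Ioo_subset_Icc_self h.center_mem_Ioo) hμ)
  obtain ⟨C, hC⟩ := (Metric.isCompact_of_isClosed_isBounded (isClosed_Icc.reProdIm isClosed_Icc)
    ((Metric.isBounded_Icc _ _).reProdIm (Metric.isBounded_Icc _ _))).exists_bound_of_continuousOn
      h.continuousOn
  refine intervalIntegral.tendsto_integral_filter_of_dominated_convergence (fun _ => C) ?_ ?_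
    intervalIntegrable_const (ae_of_all _ fun t ht => h.tendsto (hsub ht))
  · filter_upwards [self_mem_nhdsWithin] with ε (hε : 0 < ε)
    exact (continuous_im_horizontal hm hε).aestronglyMeasurable
  · filter_upwards [Ioc_mem_nhdsGT h.pos] with ε hε
    refine ae_of_all _ fun t ht => (Complex.abs_im_le_norm _).trans ?_
    rw [h.eq _ (ofReal_add_mul_I_mem_reProdIm_iff.2 ⟨hsub ht, hε⟩)]
    exact hC _ (ofReal_add_mul_I_mem_reProdIm_iff.2 ⟨hsub ht, hε.1.le, hε.2⟩)

theorem hasDerivAt_integral : HasDerivAt (fun μ => ∫ t in lam..μ, (F t).im) (F lam).im lam := by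
  have hcont : ContinuousOn (fun t : ℝ => (F t).im) (Set.Icc (lam - η) (lam + η)) :=
    Complex.continuous_im.comp_continuousOn (h.continuousOn.comp
      Complex.continuous_ofReal.continuousOn fun t ht =>
        ofReal_mem_reProdIm_iff.2 ⟨ht, le_rfl, h.pos.le⟩)
  exact intervalIntegral.integral_hasDerivAt_right .refl
    ((hcont.mono Set.Ioo_subset_Icc_self).stronglyMeasurableAtFilter isOpen_Ioo lam
      h.center_mem_Ioo)
    (hcont.continuousAt (Icc_mem_nhds_iff.2 h.center_mem_Ioo))

theorem hasDerivAt_inversion {c Λ : ℝ} {ρ : ℝ → ℝ} (hm : ContinuousOn m {z | 0 < z.im})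
    (hΛ : Λ < lam)
    (hρ : ∀ μ, Λ ≤ μ → Tendsto (fun ε : ℝ => c * ∫ t in Λ..μ, (m (t + ε * Complex.I)).im)
      (𝓝[>] 0) (𝓝 (ρ μ))) : HasDerivAt ρ (c * (F lam).im) lam := by
  have hincr : ∀ μ ∈ Set.Icc (lam - η) (lam + η), Λ ≤ μ →
      ρ μ = ρ lam + c * ∫ t in lam..μ, (F t).im := by
    intro μ hμ hΛμ
    have hlim := (h.tendsto_integral hm hμ).const_mul c
    refine eq_add_of_sub_eq' (tendsto_nhds_unique
      (((hρ μ hΛμ).sub (hρ lam hΛ.le)).congr' ?_) hlim)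
    filter_upwards [self_mem_nhdsWithin] with ε (hε : 0 < ε)
    have hcont := continuous_im_horizontal hm hε
    rw [← mul_sub, intervalIntegral.integral_interval_sub_left (hcont.intervalIntegrable _ _)
      (hcont.intervalIntegrable _ _)]
  refine ((h.hasDerivAt_integral.const_mul c).const_add (ρ lam)).congr_of_eventuallyEq ?_
  filter_upwards [Icc_mem_nhds_iff.2 h.center_mem_Ioo, Ici_mem_nhds hΛ]
    with μ hμ hΛμ using hincr μ hμ hΛμ

end IsBoundaryExtension

namespace FundamentalSystem

variable {q : ℝ → ℝ} (T : FundamentalSystem ℝ q) {ℓ lam : ℝ} (hℓ : 0 < ℓ)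
  (hD : T.disc ℓ lam ^ 2 < 4)
include hℓ hD

theorem exists_rectangle_subset_slitPlane (S : FundamentalSystem ℂ q) : ∃ η > 0,
    ∀ z ∈ Set.Icc (lam - η) (lam + η) ×ℂ Set.Icc 0 η, 4 - S.disc ℓ z ^ 2 ∈ Complex.slitPlane := by
  have hcont : Continuous fun z => 4 - S.disc ℓ z ^ 2 := by
    have := S.continuous_disc ℓ
    fun_prop
  obtain ⟨δ, hδ, hball⟩ := Metric.eventually_nhds_iff_ball.1 (hcont.continuousAt.eventually_mem
    (Complex.isOpen_slitPlane.mem_nhds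
      ((S.four_sub_disc_sq_mem_slitPlane_iff T hℓ.le lam).2 hD)))
  refine ⟨δ / 3, by positivity, fun z hz => hball z ?_⟩
  obtain ⟨hre, him⟩ := Complex.mem_reProdIm.1 hz
  rw [Metric.mem_ball, dist_eq_norm]
  have hre' : |(z - lam).re| ≤ δ / 3 := by
    rw [Complex.sub_re, Complex.ofReal_re, abs_le]
    exact ⟨by linarith [hre.1], by linarith [hre.2]⟩
  have him' : |(z - lam).im| ≤ δ / 3 := by
    rw [Complex.sub_im, Complex.ofReal_im, sub_zero, abs_of_nonneg him.1]
    exact him.2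
  linarith [Complex.norm_le_abs_re_add_abs_im (z - lam)]

theorem exists_isBoundaryExtension_weylM (hper : Function.Periodic q ℓ) (α : ℝ) :
    ∃ F η, IsBoundaryExtension (weylM q α) F lam η ∧ |(F lam).im| =
      √(4 - T.disc ℓ lam ^ 2) / 2 / |T.monodromyForm ℓ lam (-Real.sin α) (Real.cos α)| := by
  obtain ⟨S⟩ := FundamentalSystem.nonempty (𝕜 := ℂ) T.locallyIntegrable
  obtain ⟨η, hη, hslit⟩ := T.exists_rectangle_subset_slitPlane hℓ hD S
  have hsub : Set.Icc (lam - η) (lam + η) ×ℂ Set.Ioc 0 η ⊆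
      Set.Icc (lam - η) (lam + η) ×ℂ Set.Icc 0 η := fun z hz => ⟨hz.1, hz.2.1.le, hz.2.2⟩
  obtain ⟨σ, hσ, hdecay⟩ := S.exists_isDecayingMultiplier_multiplier hℓ
    (isPreconnected_reProdIm (convex_Icc (lam - η) (lam + η)) (convex_Ioc 0 η))
    (fun z hz => hz.2.1) fun z hz => hslit z (hsub hz)
  refine ⟨fun z => S.weylFormula ℓ α z (multiplier σ (S.disc ℓ z)), η, ⟨hη, ?_, fun z hz =>
    (hdecay z hz).weylM_eq hℓ hz.2.1 hper α⟩, S.abs_im_weylFormula_multiplier T hℓ.le hD hσ α⟩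
  refine S.continuousOn_weylFormula α
    ((continuousOn_multiplier σ).comp (S.continuous_disc ℓ).continuousOn hslit) fun z hz => ?_
  rcases hz.2.1.eq_or_lt with him | him
  · lift z to ℝ using him.symm
    exact S.im_conj_v_mul_multiplier_sub_u_ne_zero T hℓ.le
      ((S.four_sub_disc_sq_mem_slitPlane_iff T hℓ.le z).1 (hslit z hz)) hσ
  · exact ((hdecay z ⟨hz.1, him, hz.2.2⟩).im_pos hℓ him).ne'

end FundamentalSystem

/-! ### Oscillation in the stability set -/

theorem exists_nonpos_of_recurrence {c : ℕ → ℝ} {D : ℝ} (hD : D < 2)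
    (hc : ∀ n, c (n + 2) = D * c (n + 1) - c n) : ∃ n, c n ≤ 0 := by
  by_contra! hpos
  have hratio (n : ℕ) : c (n + 1) / c n ≤ c 1 / c 0 - n * (2 - D) := by
    induction n with
    | zero => simp
    | succ n ih =>
      have hstep : c (n + 2) / c (n + 1) = D - (c (n + 1) / c n)⁻¹ := by
        have := (hpos (n + 1)).ne'
        rw [hc]
        field_simp
      have hratio_pos : 0 < c (n + 1) / c n := div_pos (hpos _) (hpos _)
      have hAMGM : 2 ≤ c (n + 1) / c n + (c (n + 1) / c n)⁻¹ := by
        generalize c (n + 1) / c n = r at hratio_pos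
        have hsq : r + r⁻¹ - 2 = (r - 1) ^ 2 / r := by
          field_simp
          ring
        linarith [div_nonneg (sq_nonneg (r - 1)) hratio_pos.le]
      push_cast
      linarith
  obtain ⟨n, hn⟩ := exists_nat_gt (c 1 / c 0 / (2 - D))
  rw [div_lt_iff₀ (sub_pos.2 hD)] at hn
  linarith [hratio n, div_pos (hpos (n + 1)) (hpos n)]

namespace FundamentalSystem

section Recurrence

variable {𝕜 : Type*} [RCLike 𝕜] {q : ℝ → ℝ} (S : FundamentalSystem 𝕜 q)

theorem add_two_periods {ℓ : ℝ} (hℓ : 0 ≤ ℓ) (hper : Function.Periodic q ℓ) {z : 𝕜}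
    {y dy : ℝ → 𝕜} (h : IsHillSolution q z y dy) {x : ℝ} (hx : 0 ≤ x) :
    y (x + ℓ + ℓ) = S.disc ℓ z * y (x + ℓ) - y x := by
  have hperiod := h.comp_add_period S.locallyIntegrable hℓ hper
  obtain ⟨hy, hdy⟩ := S.eq_comb h hℓ
  rw [(S.translate hℓ hper hperiod hx).1, (S.translate hℓ hper h hℓ).1,
    (S.translate hℓ hper h hℓ).2, (S.translate hℓ hper h hx).1, (S.eq_comb h hx).1, hy, hdy, disc]
  linear_combination (-(y 0 * S.u z x + dy 0 * S.v z x)) * S.wronskian z hℓ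

end Recurrence

variable {q : ℝ → ℝ} (T : FundamentalSystem ℝ q) {ℓ lam : ℝ} (hℓ : 0 < ℓ)
  (hper : Function.Periodic q ℓ)
include hℓ hper

theorem isOscillatory_of_disc_lt_two (hD : T.disc ℓ lam < 2) : IsOscillatory q lam := by
  intro y dy h _ X
  by_contra! hne
  set a := max X 0
  have ha : 0 ≤ a := le_max_right _ _
  have hsame {t : ℝ} (hat : a ≤ t) : 0 < y a * y t := by
    have hcont : ContinuousOn (fun t => y a * y t) (Set.Icc a t) :=
      continuousOn_const.mul (h.continuousOn.mono fun s hs => ha.trans hs.1)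
    have hne' {s : ℝ} (hs : a ≤ s) : y s ≠ 0 := hne s (ha.trans hs) ((le_max_left X 0).trans hs)
    by_contra! hle
    obtain ⟨s, hs, hys⟩ := intermediate_value_Icc' hat hcont
      ⟨hle, (mul_self_pos.2 (hne' le_rfl)).le⟩
    exact mul_ne_zero (hne' le_rfl) (hne' hs.1) hys
  obtain ⟨n, hn⟩ := exists_nonpos_of_recurrence (c := fun n : ℕ => y a * y (a + n * ℓ)) hD
    fun n => by
      have hrec := T.add_two_periods hℓ.le hper h (x := a + n * ℓ) (by positivity)
      push_cast
      rw [show a + (n + 2) * ℓ = a + n * ℓ + ℓ + ℓ by ring, hrec,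
        show a + (n + 1) * ℓ = a + n * ℓ + ℓ by ring]
      ring
  exact hn.not_gt (hsame (le_add_of_nonneg_right (by positivity)))

theorem cutoff_lt {Λ : ℝ} (hD : T.disc ℓ lam < 2) (hΛ : IsCutoff q Λ) : Λ < lam := by
  by_contra! hle
  obtain ⟨μ, hμD, hμ : μ < lam⟩ := ((((T.continuous_disc ℓ).continuousAt.eventually_lt
    continuousAt_const hD).filter_mono nhdsWithin_le_nhds).and
      (self_mem_nhdsWithin : Set.Iio lam ∈ 𝓝[<] lam)).exists
  have hnontrivial : ∃ x, 0 ≤ x ∧ T.u μ x ≠ 0 := ⟨0, le_rfl, by simp [T.u_zero]⟩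
  obtain ⟨X, hX⟩ := hΛ.1 μ (hμ.trans_le hle) _ _ (T.solution_u μ) hnontrivial
  obtain ⟨x, hx, hXx, hzero⟩ :=
    T.isOscillatory_of_disc_lt_two hℓ hper hμD _ _ (T.solution_u μ) hnontrivial X
  exact hX x hx hXx hzero

end FundamentalSystem

/-! ### The spectral density -/

namespace FundamentalSystem

theorem monodromyForm_ne_zero {q : ℝ → ℝ} (T : FundamentalSystem ℝ q) {ℓ lam y dy : ℝ}
    (hℓ : 0 ≤ ℓ) (hD : T.disc ℓ lam ^ 2 < 4) (h0 : ¬(y = 0 ∧ dy = 0)) :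
    T.monodromyForm ℓ lam y dy ≠ 0 := by
  have hv := T.v_ne_zero hℓ hD
  have hsquares : 4 * (T.v lam ℓ * T.monodromyForm ℓ lam y dy) =
      (2 * T.v lam ℓ * dy + (T.u lam ℓ - T.dv lam ℓ) * y) ^ 2 + (4 - T.disc ℓ lam ^ 2) * y ^ 2 := by
    rw [monodromyForm]
    linear_combination y ^ 2 * T.disc_sq_sub_four hℓ lam
  intro hform
  rw [hform, mul_zero, mul_zero] at hsquares
  have hy : y = 0 := by
    by_contra hy
    have hpos := mul_pos (sub_pos.2 hD) (sq_pos_of_ne_zero hy)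
    nlinarith
  have hdy : dy = 0 := by simpa [hy, hv] using hsquares.symm
  exact h0 ⟨hy, hdy⟩

variable {q : ℝ → ℝ} (T : FundamentalSystem ℝ q) {ℓ lam : ℝ} (hℓ : 0 < ℓ)
  (hD : T.disc ℓ lam ^ 2 < 4) (hper : Function.Periodic q ℓ) (α : ℝ)
include hℓ hD hper

theorem exists_isBoundaryExtension_spectralDensity : ∃ F η,
    IsBoundaryExtension (weylM q α) F lam η ∧
    spectralDensity q α lam = 1 / Real.pi * (F lam).im ∧
    (F lam).im = √(4 - T.disc ℓ lam ^ 2) / 2 /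
      |T.monodromyForm ℓ lam (-Real.sin α) (Real.cos α)| := by
  obtain ⟨F, η, hF, habs⟩ := T.exists_isBoundaryExtension_weylM hℓ hD hper α
  have hlim := hF.tendsto (Set.Ioo_subset_Icc_self hF.center_mem_Ioo)
  refine ⟨F, η, hF, (hlim.const_mul (1 / Real.pi)).limUnder_eq, ?_⟩
  rw [← habs, abs_of_nonneg (ge_of_tendsto hlim ?_)]
  filter_upwards [self_mem_nhdsWithin] with ε (hε : 0 < ε)
  exact (weylM_im_pos T.locallyIntegrable hℓ hper α (by simpa using hε)).le

theorem spectralDensity_eq : spectralDensity q α lam = 1 / Real.pi *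
    (√(4 - T.disc ℓ lam ^ 2) / 2 / |T.monodromyForm ℓ lam (-Real.sin α) (Real.cos α)|) := by
  obtain ⟨F, η, -, hf, him⟩ := T.exists_isBoundaryExtension_spectralDensity hℓ hD hper α
  rw [hf, him]

theorem spectralDensity_pos : 0 < spectralDensity q α lam := by
  have hsqrt : 0 < √(4 - T.disc ℓ lam ^ 2) := Real.sqrt_pos.2 (sub_pos.2 hD)
  have hform : T.monodromyForm ℓ lam (-Real.sin α) (Real.cos α) ≠ 0 :=
    T.monodromyForm_ne_zero hℓ.le hD fun h => by
      simpa [neg_eq_zero.1 h.1, h.2] using Real.sin_sq_add_cos_sq α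
  rw [T.spectralDensity_eq hℓ hD hper α]
  exact mul_pos (one_div_pos.2 Real.pi_pos) (div_pos (half_pos hsqrt) (abs_pos.2 hform))

theorem tendsto_spectralDensity :
    Tendsto (fun ε : ℝ => 1 / Real.pi * (weylM q α (lam + ε * Complex.I)).im)
      (𝓝[>] 0) (𝓝 (spectralDensity q α lam)) := by
  obtain ⟨F, η, hF, hf, -⟩ := T.exists_isBoundaryExtension_spectralDensity hℓ hD hper α
  rw [hf]
  exact (hF.tendsto (Set.Ioo_subset_Icc_self hF.center_mem_Ioo)).const_mul _

theorem hasDerivAt_spectralFunction {Λ : ℝ} {ρ : ℝ → ℝ} (hΛ : IsCutoff q Λ)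
    (hρ : IsSpectralFunction q α Λ ρ) : HasDerivAt ρ (spectralDensity q α lam) lam := by
  obtain ⟨F, η, hF, hf, -⟩ := T.exists_isBoundaryExtension_spectralDensity hℓ hD hper α
  rw [hf]
  exact hF.hasDerivAt_inversion (continuousOn_weylM T.locallyIntegrable hℓ hper α)
    (T.cutoff_lt hℓ hper (lt_of_pow_lt_pow_left₀ 2 zero_le_two (by linarith)) hΛ) hρ

end FundamentalSystem

/-! ### Appell's system -/

namespace IsAppellSolution

variable {q : ℝ → ℝ} {lam : ℝ} {P Q R P₁ Q₁ R₁ : ℝ → ℝ}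

theorem of_isPrimitive (hP : IsPrimitive P fun t => (lam - q t) * Q t)
    (hQ : IsPrimitive Q fun t => -2 * P t + 2 * (lam - q t) * R t)
    (hR : IsPrimitive R fun t => -Q t) : IsAppellSolution q lam P Q R :=
  ⟨hP.continuousOn, hQ.continuousOn, hR.continuousOn, hP.eq, hQ.eq, hR.eq⟩

variable (hq : LocallyIntegrable q volume) (h : IsAppellSolution q lam P Q R)
include hq h

theorem isPrimitive : IsPrimitive P (fun t => (lam - q t) * Q t) ∧
    IsPrimitive Q (fun t => -2 * P t + 2 * (lam - q t) * R t) ∧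
    IsPrimitive R (fun t => -Q t) := by
  have hR : IsPrimitive R (fun t => -Q t) := .of_continuousOn h.continuousOn_Q.neg h.eq_R
  have hcoeff (x : ℝ) : IntervalIntegrable (fun t => lam - q t) volume 0 x :=
    intervalIntegrable_const.sub (intervalIntegrable_of_locallyIntegrable hq 0 x)
  have hsub {x : ℝ} (hx : 0 ≤ x) : Set.uIcc 0 x ⊆ Set.Ici 0 := by
    rw [Set.uIcc_of_le hx]
    exact Set.Icc_subset_Ici_self
  refine ⟨⟨fun x hx => (hcoeff x).mul_continuousOn (h.continuousOn_Q.mono (hsub hx)), h.eq_P⟩,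
    ⟨fun x hx => ?_, h.eq_Q⟩, hR⟩
  exact ((h.continuousOn_P.mono (hsub hx)).intervalIntegrable.const_mul (-2)).add
    (((hcoeff x).const_mul 2).mul_continuousOn (h.continuousOn_R.mono (hsub hx)))

theorem neg : IsAppellSolution q lam (fun x => -P x) (fun x => -Q x) (fun x => -R x) := by
  obtain ⟨hP, hQ, hR⟩ := h.isPrimitive hq
  have hneg {F f : ℝ → ℝ} (hF : IsPrimitive F f) : IsPrimitive (fun x => -F x) (fun x => -f x) :=
    by simpa only [neg_one_mul] using hF.const_mul (-1)
  exact .of_isPrimitive ((hneg hP).congr_density fun t _ => by ring)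
    ((hneg hQ).congr_density fun t _ => by ring) (hneg hR)

theorem comp_add_period {ℓ : ℝ} (hℓ : 0 ≤ ℓ) (hper : Function.Periodic q ℓ) :
    IsAppellSolution q lam (fun x => P (x + ℓ)) (fun x => Q (x + ℓ)) (fun x => R (x + ℓ)) := by
  obtain ⟨hP, hQ, hR⟩ := h.isPrimitive hq
  exact .of_isPrimitive ((hP.comp_add_right hℓ).congr_density fun t _ => by rw [hper])
    ((hQ.comp_add_right hℓ).congr_density fun t _ => by rw [hper]) (hR.comp_add_right hℓ)

theorem discr_eq {x : ℝ} (hx : 0 ≤ x) :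
    4 * P x * R x - Q x ^ 2 = 4 * P 0 * R 0 - Q 0 ^ 2 := by
  obtain ⟨hP, hQ, hR⟩ := h.isPrimitive hq
  have hconst := (((hP.mul hR).const_mul 4).sub (hQ.mul hQ)).eq_of_density_eq_zero
    (fun t _ => by ring) hx
  linear_combination hconst

theorem bilinear_eq {y dy w dw : ℝ → ℝ} (hy : IsHillSolution q lam y dy)
    (hw : IsHillSolution q lam w dw) {x : ℝ} (hx : 0 ≤ x) :
    2 * P x * (y x * w x) + Q x * (y x * dw x + dy x * w x) + 2 * R x * (dy x * dw x) =
      2 * P 0 * (y 0 * w 0) + Q 0 * (y 0 * dw 0 + dy 0 * w 0) + 2 * R 0 * (dy 0 * dw 0) := by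
  obtain ⟨hP, hQ, hR⟩ := h.isPrimitive hq
  have hdy := hy.isPrimitive_deriv hq
  have hdw := hw.isPrimitive_deriv hq
  have hy := hy.isPrimitive
  have hw := hw.isPrimitive
  refine ((((hP.const_mul 2).mul (hy.mul hw)).add (hQ.mul ((hy.mul hdw).add (hdy.mul hw)))).add
    ((hR.const_mul 2).mul (hdy.mul hdw))).eq_of_density_eq_zero (fun t _ => ?_) hx
  simp only [RCLike.ofReal_real_eq_id, id_eq]
  ring

theorem quadratic_eq {y dy : ℝ → ℝ} (hy : IsHillSolution q lam y dy) {x : ℝ} (hx : 0 ≤ x) :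
    P x * y x ^ 2 + Q x * y x * dy x + R x * dy x ^ 2 =
      P 0 * y 0 ^ 2 + Q 0 * y 0 * dy 0 + R 0 * dy 0 ^ 2 := by
  linear_combination h.bilinear_eq hq hy hy hx / 2

/-- Evaluating the conserved bilinear form on `(u, u)`, `(u, v)`, `(v, v)` gives three linear
equations for `P x`, `Q x`, `R x`, whose determinant is a power of the Wronskian. -/
theorem hasAppellCoordinates {u du v dv : ℝ → ℝ} (hu : IsHillSolution q lam u du)
    (hv : IsHillSolution q lam v dv) (hu0 : u 0 = 1) (hdu0 : du 0 = 0) (hv0 : v 0 = 0)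
    (hdv0 : dv 0 = 1) : HasAppellCoordinates u du v dv P Q R (R 0) (-Q 0) (P 0) := by
  intro x hx
  have huu := h.bilinear_eq hq hu hu hx
  have huv := h.bilinear_eq hq hu hv hx
  have hvv := h.bilinear_eq hq hv hv hx
  have hW := hu.wronskian_eq hq hv hx
  simp only [hu0, hdu0, hv0, hdv0, mul_zero, mul_one, add_zero, zero_add, sub_zero]
    at huu huv hvv hW
  have hW_sq : (u x * dv x - v x * du x) ^ 2 = 1 := by rw [hW, one_pow]
  refine ⟨?_, ?_, ?_⟩
  · linear_combination
      dv x ^ 2 / 2 * huu - du x * dv x * huv + du x ^ 2 / 2 * hvv - P x * hW_sq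
  · linear_combination -(v x * dv x) * huu + (u x * dv x + v x * du x) * huv
      - u x * du x * hvv - Q x * hW_sq
  · linear_combination v x ^ 2 / 2 * huu - u x * v x * huv + u x ^ 2 / 2 * hvv - R x * hW_sq

theorem eq_of_initial_eq (h₁ : IsAppellSolution q lam P₁ Q₁ R₁) (hP : P₁ 0 = P 0)
    (hQ : Q₁ 0 = Q 0) (hR : R₁ 0 = R 0) {x : ℝ} (hx : 0 ≤ x) :
    P₁ x = P x ∧ Q₁ x = Q x ∧ R₁ x = R x := by
  obtain ⟨T⟩ := FundamentalSystem.nonempty (𝕜 := ℝ) hq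
  have hcoord := h.hasAppellCoordinates hq (T.solution_u lam) (T.solution_v lam)
    (T.u_zero lam) (T.du_zero lam) (T.v_zero lam) (T.dv_zero lam) x hx
  have hcoord₁ := h₁.hasAppellCoordinates hq (T.solution_u lam) (T.solution_v lam)
    (T.u_zero lam) (T.du_zero lam) (T.v_zero lam) (T.dv_zero lam) x hx
  rw [hP, hQ, hR] at hcoord₁
  exact ⟨hcoord₁.1.trans hcoord.1.symm, hcoord₁.2.1.trans hcoord.2.1.symm,
    hcoord₁.2.2.trans hcoord.2.2.symm⟩

end IsAppellSolution

theorem HasAppellCoordinates.initial_eq {u du v dv P Q R : ℝ → ℝ} {a b c : ℝ}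
    (h : HasAppellCoordinates u du v dv P Q R a b c) (hu0 : u 0 = 1) (hdu0 : du 0 = 0)
    (hv0 : v 0 = 0) (hdv0 : dv 0 = 1) : P 0 = c ∧ Q 0 = -b ∧ R 0 = a := by
  simpa [hu0, hdu0, hv0, hdv0] using h 0 le_rfl

theorem IsHillSolution.isAppellSolution {q : ℝ → ℝ} (hq : LocallyIntegrable q volume) {lam : ℝ}
    {u du v dv : ℝ → ℝ} (hu : IsHillSolution q lam u du) (hv : IsHillSolution q lam v dv)
    (a b c : ℝ) : IsAppellSolution q lam
      (fun x => a * (du x * du x) + b * (du x * dv x) + c * (dv x * dv x))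
      (fun x => a * (-2 * (u x * du x)) + b * (-1 * (du x * v x + u x * dv x)) +
        c * (-2 * (v x * dv x)))
      (fun x => a * (u x * u x) + b * (u x * v x) + c * (v x * v x)) := by
  have hdu := hu.isPrimitive_deriv hq
  have hdv := hv.isPrimitive_deriv hq
  have hu := hu.isPrimitive
  have hv := hv.isPrimitive
  refine .of_isPrimitive
    (((((hdu.mul hdu).const_mul a).add ((hdu.mul hdv).const_mul b)).add
      ((hdv.mul hdv).const_mul c)).congr_density fun x _ => ?_)
    ((((((hu.mul hdu).const_mul (-2)).const_mul a).add
      ((((hdu.mul hv).add (hu.mul hdv)).const_mul (-1)).const_mul b)).add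
      (((hv.mul hdv).const_mul (-2)).const_mul c)).congr_density fun x _ => ?_)
    (((((hu.mul hu).const_mul a).add ((hu.mul hv).const_mul b)).add
      ((hv.mul hv).const_mul c)).congr_density fun x _ => by ring)
  all_goals
    simp only [RCLike.ofReal_real_eq_id, id_eq]
    ring

theorem exists_isAppellSolution {q : ℝ → ℝ} (hq : LocallyIntegrable q volume)
    (lam p₀ q₀ r₀ : ℝ) : ∃ P Q R : ℝ → ℝ,
    IsAppellSolution q lam P Q R ∧ P 0 = p₀ ∧ Q 0 = q₀ ∧ R 0 = r₀ := by
  obtain ⟨T⟩ := FundamentalSystem.nonempty (𝕜 := ℝ) hq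
  refine ⟨_, _, _, (T.solution_u lam).isAppellSolution hq (T.solution_v lam) r₀ (-q₀) p₀,
    ?_, ?_, ?_⟩ <;>
  simp [T.u_zero, T.du_zero, T.v_zero, T.dv_zero]

namespace FundamentalSystem

variable {q : ℝ → ℝ} (T : FundamentalSystem ℝ q) {ℓ lam : ℝ}

/-- The initial values are the coefficients of `monodromyForm`, which the monodromy matrix
preserves. -/
theorem exists_isNormalizedPeriodicAppell (hℓ : 0 ≤ ℓ) (hper : Function.Periodic q ℓ)
    (hD : T.disc ℓ lam ^ 2 < 4) : ∃ P Q R : ℝ → ℝ, IsNormalizedPeriodicAppell q ℓ lam P Q R := by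
  obtain ⟨k, hk⟩ : ∃ k : ℝ, k ^ 2 * (4 - T.disc ℓ lam ^ 2) = 4 := by
    refine ⟨2 / √(4 - T.disc ℓ lam ^ 2), ?_⟩
    rw [div_pow, Real.sq_sqrt (sub_pos.2 hD).le, div_mul_cancel₀ _ (sub_pos.2 hD).ne']
    norm_num
  obtain ⟨P, Q, R, h, hP0, hQ0, hR0⟩ := exists_isAppellSolution T.locallyIntegrable lam
    (k * -T.du lam ℓ) (k * (T.u lam ℓ - T.dv lam ℓ)) (k * T.v lam ℓ)
  obtain ⟨hPℓ, hQℓ, hRℓ⟩ := h.hasAppellCoordinates T.locallyIntegrable (T.solution_u lam)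
    (T.solution_v lam) (T.u_zero lam) (T.du_zero lam) (T.v_zero lam) (T.dv_zero lam) ℓ hℓ
  rw [hP0, hQ0, hR0] at hPℓ hQℓ hRℓ
  have hW := T.wronskian lam hℓ
  have hP : P (0 + ℓ) = P 0 := by
    rw [zero_add, hPℓ, hP0]
    linear_combination -(k * T.du lam ℓ) * hW
  have hQ : Q (0 + ℓ) = Q 0 := by
    rw [zero_add, hQℓ, hQ0]
    linear_combination k * (T.u lam ℓ - T.dv lam ℓ) * hW
  have hR : R (0 + ℓ) = R 0 := by
    rw [zero_add, hRℓ, hR0]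
    linear_combination k * T.v lam ℓ * hW
  have hperiodic {x : ℝ} (hx : 0 ≤ x) := h.eq_of_initial_eq T.locallyIntegrable
    (h.comp_add_period T.locallyIntegrable hℓ hper) hP hQ hR hx
  refine ⟨P, Q, R, h, fun x hx => (hperiodic hx).1, fun x hx => (hperiodic hx).2.1,
    fun x hx => (hperiodic hx).2.2, fun x hx => ?_⟩
  rw [h.discr_eq T.locallyIntegrable hx, hP0, hQ0, hR0]
  linear_combination hk + k ^ 2 * T.disc_sq_sub_four hℓ lam

variable (hℓ : 0 ≤ ℓ) (hD : T.disc ℓ lam ^ 2 < 4)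
include hℓ hD

theorem exists_initial_eq_of_isNormalizedPeriodicAppell {P Q R : ℝ → ℝ}
    (h : IsNormalizedPeriodicAppell q ℓ lam P Q R) :
    ∃ k : ℝ, k ^ 2 * (4 - T.disc ℓ lam ^ 2) = 4 ∧ P 0 = k * -T.du lam ℓ ∧
      Q 0 = k * (T.u lam ℓ - T.dv lam ℓ) ∧ R 0 = k * T.v lam ℓ := by
  have hq := T.locallyIntegrable
  have hv := T.v_ne_zero hℓ hD
  have hW := T.wronskian lam hℓ
  have huv := h.solution.bilinear_eq hq (T.solution_u lam) (T.solution_v lam) hℓ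
  have hvv := h.solution.bilinear_eq hq (T.solution_v lam) (T.solution_v lam) hℓ
  have hPℓ : P ℓ = P 0 := by simpa using h.periodic_P 0 le_rfl
  have hQℓ : Q ℓ = Q 0 := by simpa using h.periodic_Q 0 le_rfl
  have hRℓ : R ℓ = R 0 := by simpa using h.periodic_R 0 le_rfl
  simp only [T.u_zero, T.du_zero, T.v_zero, T.dv_zero, hPℓ, hQℓ, hRℓ, mul_zero, mul_one, add_zero,
    zero_add] at huv hvv
  obtain ⟨k, hR⟩ : ∃ k, R 0 = k * T.v lam ℓ := ⟨R 0 / T.v lam ℓ, (div_mul_cancel₀ _ hv).symm⟩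
  have hP : P 0 = k * -T.du lam ℓ := mul_right_cancel₀ hv <| by
    linear_combination T.dv lam ℓ / 2 * huv - T.du lam ℓ / 2 * hvv
      - (P 0 * T.v lam ℓ + Q 0 / 2 * T.dv lam ℓ) * hW - T.du lam ℓ * hR
  have hQ : Q 0 = k * (T.u lam ℓ - T.dv lam ℓ) := mul_right_cancel₀ hv <| by
    linear_combination -T.v lam ℓ / 2 * huv + T.u lam ℓ / 2 * hvv
      - (Q 0 / 2 * T.v lam ℓ + R 0 * T.dv lam ℓ) * hW + (T.u lam ℓ - T.dv lam ℓ) * hR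
  have hnorm := h.normalized 0 le_rfl
  rw [hP, hQ, hR] at hnorm
  exact ⟨k, by linear_combination hnorm - k ^ 2 * T.disc_sq_sub_four hℓ lam, hP, hQ, hR⟩

theorem eq_or_eq_neg_of_isNormalizedPeriodicAppell {P Q R P₁ Q₁ R₁ : ℝ → ℝ}
    (h : IsNormalizedPeriodicAppell q ℓ lam P Q R)
    (h₁ : IsNormalizedPeriodicAppell q ℓ lam P₁ Q₁ R₁) :
    (∀ x, 0 ≤ x → P₁ x = P x ∧ Q₁ x = Q x ∧ R₁ x = R x) ∨
      ∀ x, 0 ≤ x → P₁ x = -P x ∧ Q₁ x = -Q x ∧ R₁ x = -R x := by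
  obtain ⟨k, hk, hP, hQ, hR⟩ := T.exists_initial_eq_of_isNormalizedPeriodicAppell hℓ hD h
  obtain ⟨k₁, hk₁, hP₁, hQ₁, hR₁⟩ := T.exists_initial_eq_of_isNormalizedPeriodicAppell hℓ hD h₁
  have hsq : k₁ ^ 2 = k ^ 2 := mul_right_cancel₀ (sub_pos.2 hD).ne' (hk₁.trans hk.symm)
  have hq := T.locallyIntegrable
  rcases sq_eq_sq_iff_eq_or_eq_neg.1 hsq with rfl | rfl
  · exact .inl fun x hx => h.solution.eq_of_initial_eq hq h₁.solution
      (hP₁.trans hP.symm) (hQ₁.trans hQ.symm) (hR₁.trans hR.symm) hx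
  · rw [neg_mul, ← hP] at hP₁
    rw [neg_mul, ← hQ] at hQ₁
    rw [neg_mul, ← hR] at hR₁
    exact .inr fun x hx =>
      (h.solution.neg hq).eq_of_initial_eq hq h₁.solution hP₁ hQ₁ hR₁ hx

end FundamentalSystem

theorem FundamentalSystem.spectralDensity_eq_of_isNormalizedPeriodicAppell {q : ℝ → ℝ}
    (T : FundamentalSystem ℝ q) {ℓ lam : ℝ} (hℓ : 0 < ℓ) (hD : T.disc ℓ lam ^ 2 < 4)
    (hper : Function.Periodic q ℓ) (α : ℝ) {P Q R : ℝ → ℝ}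
    (h : IsNormalizedPeriodicAppell q ℓ lam P Q R) : spectralDensity q α lam =
      |1 / (Real.pi * (P 0 * Real.sin α ^ 2 - Q 0 * Real.sin α * Real.cos α
        + R 0 * Real.cos α ^ 2))| := by
  obtain ⟨k, hk, hP, hQ, hR⟩ := T.exists_initial_eq_of_isNormalizedPeriodicAppell hℓ.le hD h
  have hsqrt : 0 < √(4 - T.disc ℓ lam ^ 2) := Real.sqrt_pos.2 (sub_pos.2 hD)
  have hk_mul : |k| * √(4 - T.disc ℓ lam ^ 2) = 2 := by
    refine (sq_eq_sq₀ (by positivity) zero_le_two).1 ?_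
    rw [mul_pow, sq_abs, Real.sq_sqrt (sub_pos.2 hD).le, hk]
    norm_num
  have hk_abs : |k| = 2 / √(4 - T.disc ℓ lam ^ 2) := eq_div_of_mul_eq hsqrt.ne' hk_mul
  have hform : P 0 * Real.sin α ^ 2 - Q 0 * Real.sin α * Real.cos α + R 0 * Real.cos α ^ 2 =
      k * T.monodromyForm ℓ lam (-Real.sin α) (Real.cos α) := by
    rw [hP, hQ, hR, monodromyForm]
    ring
  rw [T.spectralDensity_eq hℓ hD hper α, hform, abs_div, abs_mul, abs_mul,
    abs_of_pos Real.pi_pos, hk_abs, abs_one]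
  field_simp

theorem theorem2 (q : ℝ → ℝ) (ℓ : ℝ) (hℓ : 0 < ℓ) (hper : Function.Periodic q ℓ)
    (hq : LocallyIntegrable q volume) (α : ℝ) (hα : α ∈ Set.Ico 0 Real.pi)
    (lam : ℝ) (hlam : InStabilityInterval q ℓ lam) :
    -- the normalized periodic solution of Appell's system exists and is unique up to sign
    (∃ P Q R : ℝ → ℝ, IsNormalizedPeriodicAppell q ℓ lam P Q R) ∧
    (∀ P Q R P₁ Q₁ R₁ : ℝ → ℝ, IsNormalizedPeriodicAppell q ℓ lam P Q R →
      IsNormalizedPeriodicAppell q ℓ lam P₁ Q₁ R₁ →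
      (∀ x, 0 ≤ x → P₁ x = P x ∧ Q₁ x = Q x ∧ R₁ x = R x) ∨
      (∀ x, 0 ≤ x → P₁ x = -P x ∧ Q₁ x = -Q x ∧ R₁ x = -R x)) ∧
    -- the limit that defines the spectral density exists, is positive, and is the derivative of
    -- the spectral function
    Tendsto (fun ε : ℝ => 1 / Real.pi * (weylM q α (lam + ε * Complex.I)).im)
      (𝓝[>] 0) (𝓝 (spectralDensity q α lam)) ∧
    0 < spectralDensity q α lam ∧
    (∀ (Λ : ℝ) (ρ : ℝ → ℝ), IsCutoff q Λ → IsSpectralFunction q α Λ ρ →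
      HasDerivAt ρ (spectralDensity q α lam) lam) ∧
    -- the three representations
    ∀ P Q R : ℝ → ℝ, IsNormalizedPeriodicAppell q ℓ lam P Q R →
      (∀ u du v dv : ℝ → ℝ, IsHillSolution q lam u du → IsHillSolution q lam v dv →
        u 0 = 1 → du 0 = 0 → v 0 = 0 → dv 0 = 1 →
        (∃ a b c : ℝ, HasAppellCoordinates u du v dv P Q R a b c) ∧
        ∀ a b c : ℝ, HasAppellCoordinates u du v dv P Q R a b c →
          spectralDensity q α lam =
            |1 / (Real.pi * (c * Real.sin α ^ 2 + b * Real.sin α * Real.cos α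
              + a * Real.cos α ^ 2))|) ∧
      spectralDensity q α lam =
        |1 / (Real.pi * (P 0 * Real.sin α ^ 2 - Q 0 * Real.sin α * Real.cos α
          + R 0 * Real.cos α ^ 2))| ∧
      ∀ φ dφ : ℝ → ℝ, IsHillSolution q lam φ dφ → φ 0 = -Real.sin α → dφ 0 = Real.cos α →
        ∀ x, 0 ≤ x →
          P x * φ x ^ 2 + Q x * φ x * dφ x + R x * dφ x ^ 2 =
            P 0 * φ 0 ^ 2 + Q 0 * φ 0 * dφ 0 + R 0 * dφ 0 ^ 2 ∧
          spectralDensity q α lam =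
            |1 / (Real.pi * (P x * φ x ^ 2 + Q x * φ x * dφ x + R x * dφ x ^ 2))| := by
  obtain ⟨T⟩ := FundamentalSystem.nonempty (𝕜 := ℝ) hq
  have hD := T.disc_sq_lt_four hℓ hlam
  refine ⟨T.exists_isNormalizedPeriodicAppell hℓ.le hper hD,
    fun _ _ _ _ _ _ => T.eq_or_eq_neg_of_isNormalizedPeriodicAppell hℓ.le hD,
    T.tendsto_spectralDensity hℓ hD hper α, T.spectralDensity_pos hℓ hD hper α,
    fun _ _ => T.hasDerivAt_spectralFunction hℓ hD hper α, fun P Q R h => ?_⟩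
  have hdensity := T.spectralDensity_eq_of_isNormalizedPeriodicAppell hℓ hD hper α h
  refine ⟨fun u du v dv hu hv hu0 hdu0 hv0 hdv0 => ⟨⟨_, _, _,
    h.solution.hasAppellCoordinates hq hu hv hu0 hdu0 hv0 hdv0⟩, fun a b c hcoord => ?_⟩,
    hdensity, fun φ dφ hφ hφ0 hdφ0 x hx => ⟨h.solution.quadratic_eq hq hφ hx, ?_⟩⟩
  · obtain ⟨hP, hQ, hR⟩ := hcoord.initial_eq hu0 hdu0 hv0 hdv0
    rw [hdensity, hP, hQ, hR]
    ring_nf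
  · rw [hdensity, h.solution.quadratic_eq hq hφ hx, hφ0, hdφ0]
    ring_nf
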